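/- Let $M\ge 1$, $\mathcal J=\{1,\dots,M\}$, $\lambda,\mu>0$, $C_j>0$ and $\gamma_j\ge 0$ for $j\in\mathcal J$, $\sum_{j\in\mathcal J}\gamma_j=1$, and put $\nu_j=\lambda/(\mu C_j)$. Let $$\bar{\mathcal U}=\{(g_n)_{n\ge 0}: g_0=1,\ g_n\ge g_{n+1}\ge 0\ \text{for all } n\ge 0\},\qquad \mathcal U=\Big\{g\in\bar{\mathcal U}:\sum_{n\ge 0} g_n<\infty\Big\},$$ and equip $\bar{\mathcal U}^M$ and $\mathcal U^M$ with the distance given by the norm $\|u\|=\sup_{j\in\mathcal J}\sup_{n\ge 0}|u^{(j)}_n|/(n+1)$. For $u=(u^{(j)}_n)_{j\in\mathcal J,\,n\ge 0}$ let $h^{(j)}_0(u)=0$ and, for $n\ge 1$, $$h^{(j)}_n(u)=\lambda\big(u^{(j)}_{n-1}-u^{(j)}_n\big)\sum_{i=1}^M\gamma_i\big(u^{(i)}_{n-1}+u^{(i)}_n\big)-\mu C_j\big(u^{(j)}_n-u^{(j)}_{n+1}\big).$$ (i) For every $g\in\bar{\mathcal U}^M$ the system $\dot u(t)=h(u(t))$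 (in every coordinate), $u(0)=g$, has a unique solution $u(t,g)$, $t\ge 0$, with values in $\bar{\mathcal U}^M$. Suppose from now on that $$\sum_{j\in\mathcal I}\frac{\gamma_j}{\nu_j}>\Big(\sum_{j\in\mathcal I}\gamma_j\Big)^2\quad\text{for all nonempty } \mathcal I\subseteq\mathcal J.$$ (ii) There is exactly one $P\in\mathcal U^M$ with $h(P)=0$. Moreover, for all $k\ge 0$ and $j\in\mathcal J$, $$P^{(j)}_{k+1}=\nu_j\Big[\gamma_j\big(P^{(j)}_k\big)^2+P^{(j)}_k\sum_{i\ne j}\gamma_iP^{(i)}_k+\sum_{i\ne j}\sum_{l=k}^\infty\gamma_i\big(P^{(i)}_{l+1}P^{(j)}_l-P^{(i)}_lP^{(j)}_{l+1}\big)\Big],$$ where the series converge; for all $k\ge 0$, $$\sum_{j=1}^M\frac{\gamma_j}{\nu_j}P^{(j)}_{k+1}=\Big(\sum_{j=1}^M\gamma_jP^{(j)}_k\Big)^2;$$ and for each $j$ the sequence $(P^{(j)}_k)_k$ decreases doubly exponentially, i.e. there are an integer $L>0$ and reals $\omega\in(0,1)$, $\theta>1$, $\kappa>0$ with $P^{(j)}_k\le\kappa\,\omega^{\theta^k}$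 for all $k\ge L$. (iii) For every $g\in\mathcal U^M$, $\|u(t,g)-P\|\to 0$ as $t\to\infty$. -/

import Mathlib

namespace SQ2

/-- Tails: sequences `g` with `g 0 = 1` and `g n ≥ g (n + 1) ≥ 0` for all `n`. -/
def Ubar : Set (ℕ → ℝ) :=
  {g | g 0 = 1 ∧ ∀ n, g (n + 1) ≤ g n ∧ 0 ≤ g (n + 1)}

/-- Tails with finite mean. -/
def U : Set (ℕ → ℝ) :=
  {g | g ∈ Ubar ∧ Summable g}

/-- The `M`-fold power of `Ubar`; the point `u` has the coordinates `u j n`. -/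
def UbarM (M : ℕ) : Set (Fin M → ℕ → ℝ) :=
  {u | ∀ j, u j ∈ Ubar}

/-- The `M`-fold power of `U`. -/
def UM (M : ℕ) : Set (Fin M → ℕ → ℝ) :=
  {u | ∀ j, u j ∈ U}

/-- The norm `sup_j sup_n |u j n| / (n + 1)`. On differences of points of `UbarM M` all these
quotients are at most `1`, so the real supremum is the honest one there. -/
noncomputable def wnorm {M : ℕ} (u : Fin M → ℕ → ℝ) : ℝ :=
  ⨆ j : Fin M, ⨆ n : ℕ, |u j n| / ((n : ℝ) + 1)

/-- The mean-field vector field: arrival rate `lam`, service parameter `μ`, capacities `C`,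
proportions `γ`. -/
def h {M : ℕ} (lam μ : ℝ) (C γ : Fin M → ℝ) (u : Fin M → ℕ → ℝ) (j : Fin M) : ℕ → ℝ
  | 0 => 0
  | n + 1 =>
      lam * (u j n - u j (n + 1)) * (∑ i, γ i * (u i n + u i (n + 1)))
        - μ * C j * (u j (n + 1) - u j (n + 2))

/-- `u` is a solution on `[0, ∞)` of `u' = h(u)`, `u(0) = g`, with values in `UbarM M`
(the derivative at `t = 0` is one-sided). Only the values `u t` with `t ≥ 0` matter. -/
structure IsSolution {M : ℕ} (lam μ : ℝ) (C γ : Fin M → ℝ) (g : Fin M → ℕ → ℝ)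
    (u : ℝ → Fin M → ℕ → ℝ) : Prop where
  mem : ∀ t, 0 ≤ t → u t ∈ UbarM M
  init : u 0 = g
  deriv : ∀ t, 0 ≤ t → ∀ j n,
    HasDerivWithinAt (fun s => u s j n) (h lam μ C γ (u t) j n) (Set.Ici 0) t

/-- `P` is an equilibrium (fixed) point: `h(P) = 0`. -/
def IsFixedPoint {M : ℕ} (lam μ : ℝ) (C γ : Fin M → ℝ) (P : Fin M → ℕ → ℝ) : Prop :=
  ∀ j n, h lam μ C γ P j n = 0

/-- `ν_j = lam / (μ C_j)`. -/
noncomputable def nu {M : ℕ} (lam μ : ℝ) (C : Fin M → ℝ) (j : Fin M) : ℝ :=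
  lam / (μ * C j)

/-- The stability condition, over all nonempty sets `I` of classes. -/
def StabilityCondition {M : ℕ} (lam μ : ℝ) (C γ : Fin M → ℝ) : Prop :=
  ∀ I : Finset (Fin M), I.Nonempty → ∑ j ∈ I, γ j / nu lam μ C j > (∑ j ∈ I, γ j) ^ 2

/-- Doubly exponential decrease of a sequence. -/
def DoublyExpDecreasing (z : ℕ → ℝ) : Prop :=
  ∃ (L : ℕ) (ω θ κ : ℝ), 0 < L ∧ 0 < ω ∧ ω < 1 ∧ 1 < θ ∧ 0 < κ ∧
    ∀ n, L ≤ n → z n ≤ κ * ω ^ (θ ^ n : ℝ)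

end SQ2

/-! With `rate` = 2λ + μ ΣC, the system reads u' = rate · (`euler` u - u), where the Euler step maps
`UbarM` into itself (`euler_mem`) and is monotone (`euler_mono`). Order does most of the work.
Picard iteration for this relaxation equation, started at the least point, increases to a solution.
Solutions with ordered initial values stay ordered (`IsSolution.mono`), which gives uniqueness.

The second ingredient is the telescoping identity `sum_agg_h`: averaged with weights γ, the arrival
term is a difference of squares of the aggregates a_n = Σ γ_i u_n^(i), and the service term is
itself a difference.

The Euler iterates of the least point increase to an equilibrium P. Each iterate has finite support
and h ≥ 0, so telescoping gives Σ (γ_j/ν_j) P_{m+1} ≤ a_m², an inequality that survives the limit.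
Letting m → ∞, the limits q_j of P^(j) satisfy Σ (γ_j/ν_j) q_j ≤ (Σ γ_j q_j)² in the unit cube, and
the stability condition forces q = 0 (`eq_zero_of_sum_le_sq`). Hence a_{n+1} ≤ const · a_n² with a_n
→ 0, so the decay is doubly exponential and the mean is finite. Once the mean is finite the boundary
terms vanish, so the summed stationary equations become the stated identities.

For convergence, take ordered solutions u ≤ v, with v of finite initial mean. The γ-averaged sum of
the gaps beyond coordinate m is a Lyapunov functional: by induction on m, the time integral of the
gap in each coordinate is bounded (`gapIntegral_bound`). A nonnegative Lipschitz function with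
bounded integral tends to 0. Comparing both u and the constant solution P with the solution started
at g ⊔ P gives u → P; applied to another constant solution, this is uniqueness of P. -/

namespace SQ2

/-! ### The vector field, its Euler step and the telescoping identity -/

/-- The standing assumptions on the parameters. -/
structure Admissible {M : ℕ} (lam μ : ℝ) (C γ : Fin M → ℝ) : Prop where
  lam_pos : 0 < lam
  mu_pos : 0 < μ
  C_pos : ∀ j, 0 < C j
  γ_nonneg : ∀ j, 0 ≤ γ j
  γ_sum : ∑ j, γ j = 1

/-- The `γ`-average over the classes of the `n`-th coordinates. -/
def agg {M : ℕ} (γ : Fin M → ℝ) (x : Fin M → ℕ → ℝ) (n : ℕ) : ℝ := ∑ i, γ i * x i n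

/-- A bound on the total transition rate. -/
def rate {M : ℕ} (lam μ : ℝ) (C : Fin M → ℝ) : ℝ := 2 * lam + μ * ∑ j, C j

/-- The Euler step of length `1 / rate` for the field `h`. -/
noncomputable def euler {M : ℕ} (lam μ : ℝ) (C γ : Fin M → ℝ) (x : Fin M → ℕ → ℝ) :
    Fin M → ℕ → ℝ :=
  fun j n => x j n + h lam μ C γ x j n / rate lam μ C

/-- The least point of `UbarM M`: all queues are empty. -/
def bot (M : ℕ) : Fin M → ℕ → ℝ := fun _ n => if n = 0 then 1 else 0

variable {M : ℕ} {lam μ : ℝ} {C γ : Fin M → ℝ} {x u v w g : Fin M → ℕ → ℝ}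

theorem zero_of_mem (hx : x ∈ UbarM M) (j : Fin M) : x j 0 = 1 := (hx j).1

theorem antitone_of_mem (hx : x ∈ UbarM M) (j : Fin M) : Antitone (x j) :=
  antitone_nat_of_succ_le fun n => ((hx j).2 n).1

theorem nonneg_of_mem (hx : x ∈ UbarM M) (j : Fin M) (n : ℕ) : 0 ≤ x j n := by
  cases n with
  | zero => rw [zero_of_mem hx]; exact zero_le_one
  | succ n => exact ((hx j).2 n).2

theorem le_one_of_mem (hx : x ∈ UbarM M) (j : Fin M) (n : ℕ) : x j n ≤ 1 := by
  rw [← zero_of_mem hx j]; exact antitone_of_mem hx j (Nat.zero_le n)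

theorem bot_mem (M : ℕ) : bot M ∈ UbarM M := by
  intro j
  refine ⟨by simp [bot], fun n => ⟨?_, by simp [bot]⟩⟩
  by_cases hn : n = 0 <;> simp [bot, hn]

theorem bot_le (hx : x ∈ UbarM M) : bot M ≤ x := by
  intro j n
  by_cases hn : n = 0
  · subst hn; simp [bot, zero_of_mem hx]
  · simpa [bot, hn] using nonneg_of_mem hx j n

theorem sup_mem (hu : u ∈ UbarM M) (hv : v ∈ UbarM M) : u ⊔ v ∈ UbarM M := by
  intro j
  refine ⟨by simp [zero_of_mem hu, zero_of_mem hv], fun n => ⟨?_, ?_⟩⟩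
  · exact sup_le_sup ((hu j).2 n).1 ((hv j).2 n).1
  · exact le_sup_of_le_left ((hu j).2 n).2

theorem mem_of_tendsto {ι : Type*} {l : Filter ι} [l.NeBot] {y : ι → Fin M → ℕ → ℝ}
    (hy : ∀ i, y i ∈ UbarM M)
    (hlim : ∀ j n, Filter.Tendsto (fun i => y i j n) l (nhds (x j n))) : x ∈ UbarM M := by
  intro j
  refine ⟨tendsto_nhds_unique (hlim j 0) ?_, fun n => ⟨?_, ?_⟩⟩
  · simp only [zero_of_mem (hy _) j]; exact tendsto_const_nhds
  · exact le_of_tendsto_of_tendsto' (hlim j (n + 1)) (hlim j n) fun i => ((hy i j).2 n).1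
  · exact ge_of_tendsto' (hlim j (n + 1)) fun i => ((hy i j).2 n).2

theorem rate_pos (A : Admissible lam μ C γ) : 0 < rate lam μ C := by
  have := A.lam_pos
  have : 0 ≤ μ * ∑ j, C j :=
    mul_nonneg A.mu_pos.le (Finset.sum_nonneg fun j _ => (A.C_pos j).le)
  unfold rate; linarith

theorem le_rate (A : Admissible lam μ C γ) (j : Fin M) : 2 * lam + μ * C j ≤ rate lam μ C := by
  have : C j ≤ ∑ j, C j :=
    Finset.single_le_sum (fun j _ => (A.C_pos j).le) (Finset.mem_univ j)
  have := mul_le_mul_of_nonneg_left this A.mu_pos.le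
  unfold rate; linarith

theorem agg_mono (A : Admissible lam μ C γ) (huv : u ≤ v) (n : ℕ) : agg γ u n ≤ agg γ v n :=
  Finset.sum_le_sum fun i _ => mul_le_mul_of_nonneg_left (huv i n) (A.γ_nonneg i)

theorem agg_nonneg (A : Admissible lam μ C γ) (hx : x ∈ UbarM M) (n : ℕ) : 0 ≤ agg γ x n :=
  Finset.sum_nonneg fun i _ => mul_nonneg (A.γ_nonneg i) (nonneg_of_mem hx i n)

theorem agg_zero (A : Admissible lam μ C γ) (hx : x ∈ UbarM M) : agg γ x 0 = 1 := by
  simp [agg, zero_of_mem hx, A.γ_sum]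

theorem agg_antitone (A : Admissible lam μ C γ) (hx : x ∈ UbarM M) : Antitone (agg γ x) :=
  fun _ _ hmn => Finset.sum_le_sum fun i _ =>
    mul_le_mul_of_nonneg_left (antitone_of_mem hx i hmn) (A.γ_nonneg i)

theorem agg_le_one (A : Admissible lam μ C γ) (hx : x ∈ UbarM M) (n : ℕ) : agg γ x n ≤ 1 := by
  rw [← agg_zero A hx]; exact agg_antitone A hx (Nat.zero_le n)

theorem agg_le_add (A : Admissible lam μ C γ) {e : ℝ} {n : ℕ}
    (hwv : ∀ j, w j n ≤ v j n + e) : agg γ w n ≤ agg γ v n + e := by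
  calc agg γ w n ≤ ∑ i, γ i * (v i n + e) :=
        Finset.sum_le_sum fun i _ => mul_le_mul_of_nonneg_left (hwv i) (A.γ_nonneg i)
    _ = agg γ v n + e := by
        simp only [mul_add, Finset.sum_add_distrib, ← Finset.sum_mul, A.γ_sum, agg, one_mul]

theorem tendsto_agg {ι : Type*} {l : Filter ι} {y : ι → Fin M → ℕ → ℝ} {n : ℕ}
    (hlim : ∀ j, Filter.Tendsto (fun i => y i j n) l (nhds (x j n))) :
    Filter.Tendsto (fun i => agg γ (y i) n) l (nhds (agg γ x n)) :=
  tendsto_finsetSum _ fun i _ => (hlim i).const_mul _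

theorem h_zero (x : Fin M → ℕ → ℝ) (j : Fin M) : h lam μ C γ x j 0 = 0 := rfl

theorem h_succ (x : Fin M → ℕ → ℝ) (j : Fin M) (n : ℕ) :
    h lam μ C γ x j (n + 1) = lam * (x j n - x j (n + 1)) * (agg γ x n + agg γ x (n + 1))
      - μ * C j * (x j (n + 1) - x j (n + 2)) := by
  simp only [h, agg, mul_add, Finset.sum_add_distrib]

theorem tendsto_h {ι : Type*} {l : Filter ι} {y : ι → Fin M → ℕ → ℝ}
    (hlim : ∀ j n, Filter.Tendsto (fun i => y i j n) l (nhds (x j n))) (j : Fin M) (n : ℕ) :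
    Filter.Tendsto (fun i => h lam μ C γ (y i) j n) l (nhds (h lam μ C γ x j n)) := by
  cases n with
  | zero => exact tendsto_const_nhds
  | succ n =>
    simp only [h_succ]
    exact ((((hlim j n).sub (hlim j (n + 1))).const_mul _).mul
      ((tendsto_agg fun j => hlim j n).add (tendsto_agg fun j => hlim j (n + 1)))).sub
      (((hlim j (n + 1)).sub (hlim j (n + 2))).const_mul _)

theorem h_add_rate_mul (A : Admissible lam μ C γ) (x : Fin M → ℕ → ℝ) (j : Fin M) (n : ℕ) :
    h lam μ C γ x j n + rate lam μ C * x j n = rate lam μ C * euler lam μ C γ x j n := by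
  have := (rate_pos A).ne'
  unfold euler; field_simp; ring

theorem tendsto_euler {ι : Type*} {l : Filter ι} {y : ι → Fin M → ℕ → ℝ}
    (hlim : ∀ j n, Filter.Tendsto (fun i => y i j n) l (nhds (x j n))) (j : Fin M) (n : ℕ) :
    Filter.Tendsto (fun i => euler lam μ C γ (y i) j n) l (nhds (euler lam μ C γ x j n)) :=
  (hlim j n).add ((tendsto_h hlim j n).div_const _)

theorem h_succ_le (A : Admissible lam μ C γ) (hx : x ∈ UbarM M) (j : Fin M) (n : ℕ) :
    h lam μ C γ x j (n + 1) ≤ 2 * lam * (x j n - x j (n + 1)) := by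
  have h1 : 0 ≤ lam * (x j n - x j (n + 1)) :=
    mul_nonneg A.lam_pos.le (sub_nonneg.2 (antitone_of_mem hx j (Nat.le_succ n)))
  have h2 : 0 ≤ μ * C j * (x j (n + 1) - x j (n + 2)) :=
    mul_nonneg (mul_pos A.mu_pos (A.C_pos j)).le
      (sub_nonneg.2 (antitone_of_mem hx j (Nat.le_succ (n + 1))))
  have h3 : agg γ x n + agg γ x (n + 1) ≤ 2 := by
    linarith [agg_le_one A hx n, agg_le_one A hx (n + 1)]
  rw [h_succ]
  nlinarith [mul_le_mul_of_nonneg_left h3 h1]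

theorem le_h (A : Admissible lam μ C γ) (hx : x ∈ UbarM M) (j : Fin M) (n : ℕ) :
    -(μ * C j * (x j n - x j (n + 1))) ≤ h lam μ C γ x j n := by
  have hk := (mul_pos A.mu_pos (A.C_pos j)).le
  cases n with
  | zero =>
    rw [h_zero, neg_nonpos]
    exact mul_nonneg hk (sub_nonneg.2 (antitone_of_mem hx j (Nat.le_succ 0)))
  | succ n =>
    have h1 : 0 ≤ lam * (x j n - x j (n + 1)) :=
      mul_nonneg A.lam_pos.le (sub_nonneg.2 (antitone_of_mem hx j (Nat.le_succ n)))
    have h3 : 0 ≤ agg γ x n + agg γ x (n + 1) :=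
      add_nonneg (agg_nonneg A hx n) (agg_nonneg A hx (n + 1))
    rw [h_succ]
    linarith [mul_nonneg h1 h3]

/-- The increment h_{n+1} - h_n is at most (2λ + μC_j)(x_n - x_{n+1}), and h_{n+1} ≥ -μC_j x_{n+1}.
A step of length 1 / `rate` is short enough to preserve both order and sign. -/
theorem euler_mem (A : Admissible lam μ C γ) (hx : x ∈ UbarM M) :
    euler lam μ C γ x ∈ UbarM M := by
  have hK := rate_pos A
  intro j
  have hKj := le_rate A j
  refine ⟨by simp [euler, h_zero, zero_of_mem hx], fun n => ⟨?_, ?_⟩⟩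
  · refine le_of_mul_le_mul_left ?_ hK
    rw [← h_add_rate_mul A, ← h_add_rate_mul A]
    have h1 := h_succ_le A hx j n
    have h2 := le_h A hx j n
    have h3 : 0 ≤ x j n - x j (n + 1) := sub_nonneg.2 (antitone_of_mem hx j (Nat.le_succ n))
    nlinarith [mul_le_mul_of_nonneg_right hKj h3]
  · refine le_of_mul_le_mul_left ?_ hK
    rw [← h_add_rate_mul A, mul_zero]
    have h2 := le_h A hx j (n + 1)
    have h3 := nonneg_of_mem hx j (n + 1)
    have h4 := mul_nonneg (mul_pos A.mu_pos (A.C_pos j)).le (nonneg_of_mem hx j (n + 2))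
    have h5 := A.lam_pos
    nlinarith [mul_le_mul_of_nonneg_right hKj h3, mul_nonneg h5.le h3]

theorem abs_h_le (A : Admissible lam μ C γ) (hx : x ∈ UbarM M) (j : Fin M) (n : ℕ) :
    |h lam μ C γ x j n| ≤ rate lam μ C := by
  have hK := rate_pos A
  have e := h_add_rate_mul A x j n
  have h1 := mul_nonneg hK.le (nonneg_of_mem hx j n)
  have h2 := mul_nonneg hK.le (nonneg_of_mem (euler_mem A hx) j n)
  have h3 := mul_le_mul_of_nonneg_left (le_one_of_mem hx j n) hK.le
  have h4 := mul_le_mul_of_nonneg_left (le_one_of_mem (euler_mem A hx) j n) hK.le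
  rw [abs_le]; constructor <;> linarith

/-- The field is nondecreasing in every coordinate except the one it drives. There the slope is at
least -(2λ + μC_j), which the added term `rate` · x compensates. -/
theorem euler_mono (A : Admissible lam μ C γ) (hu : u ∈ UbarM M) (hv : v ∈ UbarM M)
    (huv : u ≤ v) : euler lam μ C γ u ≤ euler lam μ C γ v := by
  have hK := rate_pos A
  intro j n
  refine le_of_mul_le_mul_left ?_ hK
  rw [← h_add_rate_mul A, ← h_add_rate_mul A]
  cases n with
  | zero => simp [h_zero, zero_of_mem hu, zero_of_mem hv]
  | succ n =>
    have hd : 0 ≤ lam * (v j n - v j (n + 1)) :=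
      mul_nonneg A.lam_pos.le (sub_nonneg.2 (antitone_of_mem hv j (Nat.le_succ n)))
    have hs : agg γ u n + agg γ u (n + 1) ≤ agg γ v n + agg γ v (n + 1) :=
      add_le_add (agg_mono A huv n) (agg_mono A huv (n + 1))
    have hs0 : 0 ≤ agg γ u n + agg γ u (n + 1) :=
      add_nonneg (agg_nonneg A hu n) (agg_nonneg A hu (n + 1))
    have hs2 : agg γ u n + agg γ u (n + 1) ≤ 2 := by
      linarith [agg_le_one A hu n, agg_le_one A hu (n + 1)]
    have h0 := huv j n
    have h1 : 0 ≤ v j (n + 1) - u j (n + 1) := sub_nonneg.2 (huv j (n + 1))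
    have h2 := mul_le_mul_of_nonneg_left (huv j (n + 2)) (mul_pos A.mu_pos (A.C_pos j)).le
    have p1 := mul_le_mul_of_nonneg_left hs hd
    have p2 := mul_nonneg (mul_nonneg A.lam_pos.le (sub_nonneg.2 h0)) hs0
    have p3 := mul_le_mul_of_nonneg_left hs2 (mul_nonneg A.lam_pos.le h1)
    have p4 := mul_le_mul_of_nonneg_right (le_rate A j) h1
    rw [h_succ, h_succ]
    linarith

/-- A one-sided Lipschitz bound in the unweighted supremum. The arrival term contributes at most
4λe, service μC_j e and the relaxation term `rate` · e; by `le_rate` the total is at most 3 · `rate`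
· e. -/
theorem h_add_le_of_le_add (A : Admissible lam μ C γ) (hv : v ∈ UbarM M) (hw : w ∈ UbarM M)
    (hvw : v ≤ w) {e : ℝ} (he : 0 ≤ e) (hwv : ∀ j n, w j n ≤ v j n + e) (j : Fin M) (n : ℕ) :
    h lam μ C γ w j n + rate lam μ C * w j n ≤
      h lam μ C γ v j n + rate lam μ C * v j n + 3 * rate lam μ C * e := by
  have hK := rate_pos A
  have hl := A.lam_pos
  cases n with
  | zero =>
    rw [h_zero, h_zero, zero_of_mem hv, zero_of_mem hw]
    linarith [mul_nonneg hK.le he]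
  | succ n =>
    have hd : 0 ≤ lam * (w j n - w j (n + 1)) :=
      mul_nonneg hl.le (sub_nonneg.2 (antitone_of_mem hw j (Nat.le_succ n)))
    have hd1 : lam * (w j n - w j (n + 1)) ≤ lam * 1 :=
      mul_le_mul_of_nonneg_left
        (by linarith [le_one_of_mem hw j n, nonneg_of_mem hw j (n + 1)]) hl.le
    have hs : (agg γ w n + agg γ w (n + 1)) - (agg γ v n + agg γ v (n + 1)) ≤ 2 * e := by
      linarith [agg_le_add A (fun j => hwv j n), agg_le_add A (fun j => hwv j (n + 1))]
    have hs0 : 0 ≤ agg γ v n + agg γ v (n + 1) :=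
      add_nonneg (agg_nonneg A hv n) (agg_nonneg A hv (n + 1))
    have hs2 : agg γ v n + agg γ v (n + 1) ≤ 2 := by
      linarith [agg_le_one A hv n, agg_le_one A hv (n + 1)]
    have hmc := (mul_pos A.mu_pos (A.C_pos j)).le
    have h0 : (w j n - w j (n + 1)) - (v j n - v j (n + 1)) ≤ e := by
      linarith [hwv j n, hvw j (n + 1)]
    have p1 := mul_le_mul_of_nonneg_left hs hd
    have p1' := mul_le_mul_of_nonneg_right hd1 (mul_nonneg zero_le_two he)
    have p2 := mul_le_mul_of_nonneg_left h0 (mul_nonneg hl.le hs0)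
    have p3 := mul_le_mul_of_nonneg_left hs2 (mul_nonneg hl.le he)
    have p4 := mul_le_mul_of_nonneg_left (hwv j (n + 2)) hmc
    have p5 := mul_le_mul_of_nonneg_left (hvw j (n + 1)) hmc
    have p6 := mul_le_mul_of_nonneg_left (hwv j (n + 1)) hK.le
    have p7 := mul_le_mul_of_nonneg_right (le_rate A j) he
    have p8 := mul_nonneg hmc he
    rw [h_succ, h_succ]
    linarith

/-- Summing the field over the coordinates `m + 1, …, m + N` and over the classes. -/
theorem sum_agg_h (A : Admissible lam μ C γ) (x : Fin M → ℕ → ℝ) (m N : ℕ) :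
    ∑ n ∈ Finset.range N, ∑ j, γ j * h lam μ C γ x j (m + n + 1) =
      lam * (agg γ x m ^ 2 - agg γ x (m + N) ^ 2)
        - lam * ∑ j, γ j / nu lam μ C j * (x j (m + 1) - x j (m + N + 1)) := by
  have hl := A.lam_pos.ne'
  have hm := A.mu_pos.ne'
  have key : ∀ n, ∑ j, γ j * h lam μ C γ x j (n + 1) =
      lam * (agg γ x n ^ 2 - agg γ x (n + 1) ^ 2)
        - lam * ∑ j, γ j / nu lam μ C j * (x j (n + 1) - x j (n + 2)) := by
    intro n
    have e1 : ∀ j, γ j * h lam μ C γ x j (n + 1) =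
        lam * (agg γ x n + agg γ x (n + 1)) * (γ j * x j n - γ j * x j (n + 1))
          - lam * (γ j / nu lam μ C j * (x j (n + 1) - x j (n + 2))) := by
      intro j
      have hc := (A.C_pos j).ne'
      rw [h_succ, nu]; field_simp
    simp only [e1, Finset.sum_sub_distrib, ← Finset.mul_sum]
    simp only [← agg.eq_1]
    ring
  induction N with
  | zero => simp
  | succ N ih =>
    rw [Finset.sum_range_succ, ih, key]
    simp only [mul_sub, Finset.sum_sub_distrib, ← add_assoc]
    ring

end SQ2

/-! ### Comparison and uniqueness of solutions -/

namespace SQ2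

variable {M : ℕ} {lam μ : ℝ} {C γ : Fin M → ℝ} {g g' : Fin M → ℕ → ℝ}
  {u v : ℝ → Fin M → ℕ → ℝ}

theorem antitoneOn_of_hasDerivWithinAt_Ici {f f' : ℝ → ℝ}
    (hf : ∀ t, 0 ≤ t → HasDerivWithinAt f (f' t) (Set.Ici 0) t) (h' : ∀ t, 0 ≤ t → f' t ≤ 0) :
    AntitoneOn f (Set.Ici 0) :=
  antitoneOn_of_hasDerivWithinAt_nonpos (convex_Ici 0)
    (fun t ht => (hf t ht).continuousWithinAt)
    (fun t ht => (hf t (interior_subset ht)).mono interior_subset)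
    (fun t ht => h' t (interior_subset ht))

theorem nonpos_of_deriv_add_le {f f' : ℝ → ℝ} {K : ℝ}
    (hf : ∀ t, 0 ≤ t → HasDerivWithinAt f (f' t) (Set.Ici 0) t)
    (h' : ∀ t, 0 ≤ t → f' t + K * f t ≤ 0) (h0 : f 0 ≤ 0) {t : ℝ} (ht : 0 ≤ t) : f t ≤ 0 := by
  have hd : ∀ t, 0 ≤ t → HasDerivWithinAt (fun s => Real.exp (K * s) * f s)
      (Real.exp (K * t) * (f' t + K * f t)) (Set.Ici 0) t := by
    intro t ht
    have := (((hasDerivAt_id t).const_mul K).exp.hasDerivWithinAt (s := Set.Ici 0)).mul (hf t ht)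
    refine this.congr_deriv ?_
    simp; ring
  have := antitoneOn_of_hasDerivWithinAt_Ici hd
    (fun t ht => mul_nonpos_of_nonneg_of_nonpos (Real.exp_pos _).le (h' t ht))
    Set.self_mem_Ici ht ht
  simp only [mul_zero, Real.exp_zero, one_mul] at this
  exact nonpos_of_mul_nonpos_right (this.trans h0) (Real.exp_pos _)

/-- With infinitely many coordinates the supremum of u - v cannot simply be differentiated. Instead
a uniform bound is improved by repeated integration, coordinate by coordinate, starting from the
trivial bound 1. -/
theorem IsSolution.sub_le_pow (A : Admissible lam μ C γ) (hu : IsSolution lam μ C γ g u)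
    (hv : IsSolution lam μ C γ g' v) (hg : g ≤ g') (k : ℕ) :
    ∀ t, 0 ≤ t → ∀ j n, u t j n - v t j n ≤ (3 * rate lam μ C * t) ^ k / k.factorial := by
  have hK := rate_pos A
  induction k with
  | zero =>
    intro t ht j n
    simp only [pow_zero, Nat.factorial_zero, Nat.cast_one, div_one]
    linarith [le_one_of_mem (hu.mem t ht) j n, nonneg_of_mem (hv.mem t ht) j n]
  | succ k ih =>
    intro t ht j n
    set L := 3 * rate lam μ C with hL
    have hL0 : 0 ≤ L := by positivity
    have hB : ∀ t, HasDerivAt (fun s => (L * s) ^ (k + 1) / (k + 1).factorial)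
        (L * ((L * t) ^ k / k.factorial)) t := by
      intro t
      have := ((((hasDerivAt_id t).const_mul L).pow (k + 1)).div_const
        (((k + 1).factorial : ℕ) : ℝ))
      refine this.congr_deriv ?_
      have : ((k.factorial : ℕ) : ℝ) ≠ 0 := by positivity
      have : (k : ℝ) + 1 ≠ 0 := by positivity
      simp only [Nat.factorial_succ, Nat.cast_mul, Nat.cast_succ, id, Nat.add_sub_cancel]
      field_simp
    have := nonpos_of_deriv_add_le (K := rate lam μ C)
      (fun t ht => ((hu.deriv t ht j n).sub (hv.deriv t ht j n)).sub (hB t).hasDerivWithinAt)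
      ?_ ?_ ht
    · simpa using this
    · intro t ht
      have he : 0 ≤ (L * t) ^ k / k.factorial := by positivity
      have hB0 : 0 ≤ (L * t) ^ (k + 1) / (k + 1).factorial := by positivity
      -- The point u ⊔ v dominates u, so monotonicity applies, and exceeds v by at most the previous
      -- bound, so the one-sided Lipschitz estimate applies.
      have hm := sup_mem (hu.mem t ht) (hv.mem t ht)
      have h1 := h_add_le_of_le_add A (hv.mem t ht) hm le_sup_right he (fun j n => by
        refine sup_le ?_ ?_ <;> [linarith [ih t ht j n]; linarith]) j n
      have h2 := mul_le_mul_of_nonneg_left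
        (euler_mono A (hu.mem t ht) hm le_sup_left j n) hK.le
      rw [← h_add_rate_mul A, ← h_add_rate_mul A] at h2
      have h3 := mul_nonneg hK.le hB0
      simp only [Pi.sub_apply]
      linarith
    · simp [hu.init, hv.init]
      exact hg j n

/-- Solutions depend monotonically on the initial value. -/
theorem IsSolution.mono (A : Admissible lam μ C γ) (hu : IsSolution lam μ C γ g u)
    (hv : IsSolution lam μ C γ g' v) (hg : g ≤ g') {t : ℝ} (ht : 0 ≤ t) : u t ≤ v t := by
  intro j n
  refine sub_nonpos.1 (ge_of_tendsto' (FloorSemiring.tendsto_pow_div_factorial_atTop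
    (3 * rate lam μ C * t)) fun k => hu.sub_le_pow A hv hg k t ht j n)

theorem IsSolution.eq (A : Admissible lam μ C γ) (hu : IsSolution lam μ C γ g u)
    (hv : IsSolution lam μ C γ g v) {t : ℝ} (ht : 0 ≤ t) : u t = v t :=
  le_antisymm (hu.mono A hv le_rfl ht) (hv.mono A hu le_rfl ht)

end SQ2

/-! ### The quadratic inequality on the unit cube -/

namespace SQ2

variable {M : ℕ} {lam μ : ℝ} {C γ : Fin M → ℝ} {P x : Fin M → ℕ → ℝ}

/-- A layer-cake decomposition: subtracting the least positive value ε of q on its support I lowers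
the two sides by ε(Σ_I γ)² and ε Σ_I a. The condition on I makes each layer strict, and the support
shrinks. The bound min(q_i, q_j) ≥ q_i q_j on the cube later turns this into a statement about (Σ
γq)². -/
theorem sum_mul_sub_sum_min_pos {ι : Type*} [Fintype ι] {a γ : ι → ℝ}
    (hI : ∀ I : Finset ι, I.Nonempty → (∑ j ∈ I, γ j) ^ 2 < ∑ j ∈ I, a j) (k : ℕ) :
    ∀ q : ι → ℝ, (∀ i, 0 ≤ q i) → (Finset.univ.filter fun i => 0 < q i).card ≤ k →
      q = 0 ∨ ∑ i, ∑ j, γ i * γ j * min (q i) (q j) < ∑ i, a i * q i := by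
  classical
  induction k with
  | zero =>
    intro q hq hk
    left
    rw [Nat.le_zero, Finset.card_eq_zero, Finset.filter_eq_empty_iff] at hk
    funext i
    exact le_antisymm (not_lt.1 (hk (Finset.mem_univ i))) (hq i)
  | succ k ih =>
    intro q hq hk
    set I := Finset.univ.filter fun i => 0 < q i with hIdef
    rcases I.eq_empty_or_nonempty with hemp | hne
    · left
      rw [Finset.filter_eq_empty_iff] at hemp
      funext i
      exact le_antisymm (not_lt.1 (hemp (Finset.mem_univ i))) (hq i)
    right
    obtain ⟨i₀, hi₀, hmin⟩ := I.exists_min_image q hne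
    have hpos : 0 < q i₀ := (Finset.mem_filter.1 hi₀).2
    have hz : ∀ i, i ∉ I → q i = 0 := fun i hi => le_antisymm
      (not_lt.1 fun h => hi (Finset.mem_filter.2 ⟨Finset.mem_univ i, h⟩)) (hq i)
    set ε := q i₀
    let r : ι → ℝ := fun i => if i ∈ I then 1 else 0
    let q' : ι → ℝ := fun i => q i - ε * r i
    have hq' : ∀ i, 0 ≤ q' i := by
      intro i
      by_cases hi : i ∈ I
      · simpa [q', r, hi] using hmin i hi
      · simpa [q', r, hi] using hq i
    have hcard : (Finset.univ.filter fun i => 0 < q' i).card ≤ k := by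
      refine Nat.lt_succ_iff.1 (lt_of_lt_of_le (Finset.card_lt_card ?_) hk)
      refine Finset.ssubset_iff_of_subset ?_ |>.2 ⟨i₀, hi₀, ?_⟩
      · intro i hi
        by_contra hn
        have := (Finset.mem_filter.1 hi).2
        simp [q', r, hn, hz i hn] at this
      · simp [q', r, hi₀, ε]
    have hqe : ∀ i, q i = q' i + ε * r i := fun i => by simp [q']
    have hmine : ∀ i j, min (q i) (q j) = min (q' i) (q' j) + ε * (r i * r j) := by
      intro i j
      by_cases hi : i ∈ I <;> by_cases hj : j ∈ I
      · simp only [hqe i, hqe j, r, hi, hj, if_true, mul_one, min_add_add_right]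
      · simp [q', r, hi, hj, hz j hj, (hq i)]
        have := hmin i hi
        exact this
      · simp [q', r, hi, hj, hz i hi, (hq j)]
        have := hmin j hj
        exact this
      · simp [q', r, hi, hj]
    have hle : ∑ i, ∑ j, γ i * γ j * min (q' i) (q' j) ≤ ∑ i, a i * q' i := by
      rcases ih q' hq' hcard with h0 | h1
      · simp [h0]
      · exact h1.le
    have e1 : ∑ i, ∑ j, γ i * γ j * min (q i) (q j) =
        ∑ i, ∑ j, γ i * γ j * min (q' i) (q' j) + ε * (∑ j ∈ I, γ j) ^ 2 := by
      have : ∑ j ∈ I, γ j = ∑ j, γ j * r j := by simp [r]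
      rw [this, sq, Finset.sum_mul_sum, Finset.mul_sum, ← Finset.sum_add_distrib]
      refine Finset.sum_congr rfl fun i _ => ?_
      rw [Finset.mul_sum, ← Finset.sum_add_distrib]
      refine Finset.sum_congr rfl fun j _ => ?_
      rw [hmine]; ring
    have e2 : ∑ i, a i * q i = ∑ i, a i * q' i + ε * ∑ j ∈ I, a j := by
      have : ∑ j ∈ I, a j = ∑ j, a j * r j := by simp [r]
      rw [this, Finset.mul_sum, ← Finset.sum_add_distrib]
      refine Finset.sum_congr rfl fun i _ => ?_
      rw [hqe i]; ring
    rw [e1, e2]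
    exact add_lt_add_of_le_of_lt hle (mul_lt_mul_of_pos_left (hI I hne) hpos)

/-- Under a condition on the vertices of the unit cube only, the quadratic inequality
`∑ a q ≤ (∑ γ q) ^ 2` has no solution in the cube but `0`. -/
theorem eq_zero_of_sum_le_sq {ι : Type*} [Fintype ι] {a γ : ι → ℝ} (hγ : ∀ i, 0 ≤ γ i)
    (hI : ∀ I : Finset ι, I.Nonempty → (∑ j ∈ I, γ j) ^ 2 < ∑ j ∈ I, a j)
    {q : ι → ℝ} (hq : ∀ i, 0 ≤ q i) (hq1 : ∀ i, q i ≤ 1)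
    (h : ∑ i, a i * q i ≤ (∑ i, γ i * q i) ^ 2) : q = 0 := by
  refine (sum_mul_sub_sum_min_pos hI _ q hq le_rfl).resolve_right fun hlt => ?_
  refine absurd (h.trans ?_) (not_le.2 hlt)
  rw [sq, Finset.sum_mul_sum]
  refine Finset.sum_le_sum fun i _ => Finset.sum_le_sum fun j _ => ?_
  have : q i * q j ≤ min (q i) (q j) :=
    le_min (mul_le_of_le_one_right (hq i) (hq1 j)) (mul_le_of_le_one_left (hq j) (hq1 i))
  calc γ i * q i * (γ j * q j) = γ i * γ j * (q i * q j) := by ring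
    _ ≤ _ := mul_le_mul_of_nonneg_left this (mul_nonneg (hγ i) (hγ j))

theorem nu_pos (A : Admissible lam μ C γ) (j : Fin M) : 0 < nu lam μ C j :=
  div_pos A.lam_pos (mul_pos A.mu_pos (A.C_pos j))

theorem StabilityCondition.γ_pos (A : Admissible lam μ C γ)
    (hS : StabilityCondition lam μ C γ) (j : Fin M) : 0 < γ j := by
  refine (A.γ_nonneg j).lt_of_ne fun h0 => ?_
  have := hS {j} (Finset.singleton_nonempty j)
  simp [← h0] at this

theorem agg_le_sum_nu_mul (A : Admissible lam μ C γ) {y : Fin M → ℝ} (hy : ∀ j, 0 ≤ y j) :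
    ∑ j, γ j * y j ≤ (∑ j, nu lam μ C j) * ∑ j, γ j / nu lam μ C j * y j := by
  rw [Finset.mul_sum]
  refine Finset.sum_le_sum fun j _ => ?_
  have h1 : nu lam μ C j ≤ ∑ j, nu lam μ C j :=
    Finset.single_le_sum (fun j _ => (nu_pos A j).le) (Finset.mem_univ j)
  have h2 : 0 ≤ γ j / nu lam μ C j * y j :=
    mul_nonneg (div_nonneg (A.γ_nonneg j) (nu_pos A j).le) (hy j)
  calc γ j * y j = nu lam μ C j * (γ j / nu lam μ C j * y j) := by
        have := (nu_pos A j).ne'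
        field_simp
    _ ≤ _ := mul_le_mul_of_nonneg_right h1 h2

/-! ### Construction and decay of the equilibrium -/

/-- The Euler iterates of the least point. -/
noncomputable def eulerIter {M : ℕ} (lam μ : ℝ) (C γ : Fin M → ℝ) (k : ℕ) : Fin M → ℕ → ℝ :=
  (euler lam μ C γ)^[k] (bot M)

theorem eulerIter_succ (k : ℕ) :
    eulerIter lam μ C γ (k + 1) = euler lam μ C γ (eulerIter lam μ C γ k) :=
  Function.iterate_succ_apply' _ _ _

theorem eulerIter_mem (A : Admissible lam μ C γ) (k : ℕ) :
    eulerIter lam μ C γ k ∈ UbarM M := by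
  induction k with
  | zero => exact bot_mem M
  | succ k ih => rw [eulerIter_succ]; exact euler_mem A ih

theorem eulerIter_le_succ (A : Admissible lam μ C γ) (k : ℕ) :
    eulerIter lam μ C γ k ≤ eulerIter lam μ C γ (k + 1) := by
  induction k with
  | zero => exact bot_le (eulerIter_mem A _)
  | succ k ih =>
    rw [eulerIter_succ k, eulerIter_succ (k + 1)]
    exact euler_mono A (eulerIter_mem A _) (eulerIter_mem A _) ih

/-- One step propagates the support by one coordinate only. The finite support removes all boundary
terms from the telescoped sums. -/
theorem eulerIter_eq_zero (k : ℕ) : ∀ n, k < n → ∀ j, eulerIter lam μ C γ k j n = 0 := by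
  induction k with
  | zero => intro n hn j; simp [eulerIter, bot, Nat.pos_iff_ne_zero.1 hn]
  | succ k ih =>
    intro n hn j
    obtain ⟨n, rfl⟩ : ∃ m, n = m + 1 := ⟨n - 1, by omega⟩
    rw [eulerIter_succ, euler, h_succ, ih n (by omega), ih (n + 1) (by omega),
      ih (n + 2) (by omega)]
    simp

theorem eulerIter_sum_le_sq (A : Admissible lam μ C γ) (k m : ℕ) :
    ∑ j, γ j / nu lam μ C j * eulerIter lam μ C γ k j (m + 1) ≤
      agg γ (eulerIter lam μ C γ k) m ^ 2 := by
  set x := eulerIter lam μ C γ k with hx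
  have hh : ∀ j n, 0 ≤ h lam μ C γ x j n := by
    intro j n
    -- The iterates increase, so the increment h / `rate` is nonnegative.
    have h1 := eulerIter_le_succ A k j n
    rw [eulerIter_succ, ← hx] at h1
    have h2 : 0 ≤ h lam μ C γ x j n / rate lam μ C := by simpa [euler] using h1
    have := mul_nonneg h2 (rate_pos A).le
    rwa [div_mul_cancel₀ _ (rate_pos A).ne'] at this
  have hs := sum_agg_h A x m (k + 1)
  have h0 : 0 ≤ ∑ n ∈ Finset.range (k + 1), ∑ j, γ j * h lam μ C γ x j (m + n + 1) :=
    Finset.sum_nonneg fun n _ => Finset.sum_nonneg fun j _ => mul_nonneg (A.γ_nonneg j) (hh _ _)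
  have hz : ∀ j, x j (m + (k + 1)) = 0 := eulerIter_eq_zero k _ (by omega)
  have hz' : ∀ j, x j (m + (k + 1) + 1) = 0 := eulerIter_eq_zero k _ (by omega)
  have ha : agg γ x (m + (k + 1)) = 0 := by simp [agg, hz]
  simp only [hz', ha, sub_zero] at hs
  rw [hs, ← mul_sub, zero_pow two_ne_zero, sub_zero] at h0
  linarith [nonneg_of_mul_nonneg_right h0 A.lam_pos]

/-- The limit of the Euler iterates. -/
theorem exists_fixedPoint_sum_le_sq (A : Admissible lam μ C γ) :
    ∃ P ∈ UbarM M, IsFixedPoint lam μ C γ P ∧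
      ∀ m, ∑ j, γ j / nu lam μ C j * P j (m + 1) ≤ agg γ P m ^ 2 := by
  have hmono : ∀ j n, Monotone fun k => eulerIter lam μ C γ k j n := fun j n =>
    monotone_nat_of_le_succ fun k => eulerIter_le_succ A k j n
  have hlim : ∀ j n, Filter.Tendsto (fun k => eulerIter lam μ C γ k j n) Filter.atTop
      (nhds (⨆ k, eulerIter lam μ C γ k j n)) := fun j n =>
    tendsto_atTop_ciSup (hmono j n)
      ⟨1, by rintro _ ⟨k, rfl⟩; exact le_one_of_mem (eulerIter_mem A k) j n⟩
  refine ⟨fun j n => ⨆ k, eulerIter lam μ C γ k j n,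
    mem_of_tendsto (eulerIter_mem A) hlim, fun j n => ?_, fun m => ?_⟩
  · have h1 := tendsto_euler (lam := lam) (μ := μ) (C := C) (γ := γ) hlim j n
    have h2 := (hlim j n).comp (Filter.tendsto_add_atTop_nat 1)
    have h3 := tendsto_nhds_unique h2
      (h1.congr fun k => by rw [Function.comp_apply, eulerIter_succ])
    simpa [euler, (rate_pos A).ne'] using h3
  · exact le_of_tendsto_of_tendsto'
      (tendsto_finsetSum _ fun j _ => (hlim j (m + 1)).const_mul _)
      ((tendsto_agg fun j => hlim j m).pow 2) fun k => eulerIter_sum_le_sq A k m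

theorem tendsto_zero_of_sum_le_sq (A : Admissible lam μ C γ)
    (hS : StabilityCondition lam μ C γ) (hP : P ∈ UbarM M)
    (hle : ∀ m, ∑ j, γ j / nu lam μ C j * P j (m + 1) ≤ agg γ P m ^ 2) (j : Fin M) :
    Filter.Tendsto (P j) Filter.atTop (nhds 0) := by
  have hlim : ∀ j, Filter.Tendsto (P j) Filter.atTop (nhds (⨅ n, P j n)) := fun j =>
    tendsto_atTop_ciInf (antitone_of_mem hP j)
      ⟨0, by rintro _ ⟨n, rfl⟩; exact nonneg_of_mem hP j n⟩
  have hq : (fun j => ⨅ n, P j n) = 0 := by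
    refine eq_zero_of_sum_le_sq A.γ_nonneg hS
      (fun j => ge_of_tendsto' (hlim j) (nonneg_of_mem hP j))
      (fun j => le_of_tendsto' (hlim j) (le_one_of_mem hP j)) ?_
    refine le_of_tendsto_of_tendsto'
      (tendsto_finsetSum _ fun j _ =>
        ((hlim j).comp (Filter.tendsto_add_atTop_nat 1)).const_mul _)
      ((tendsto_finsetSum _ fun j _ => (hlim j).const_mul (γ j)).pow 2) hle
  have := hlim j
  rwa [congrFun hq j] at this

/-- The rescaled sequence B · s satisfies t_{n+1} ≤ t_n². -/
theorem le_pow_two_pow_of_succ_le_sq {s : ℕ → ℝ} {B q : ℝ} {L : ℕ} (hs : ∀ n, 0 ≤ s n)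
    (hB : 0 < B) (h : ∀ n, s (n + 1) ≤ B * s n ^ 2) (hL : B * s L ≤ q) (n : ℕ) :
    B * s (L + n) ≤ q ^ 2 ^ n := by
  induction n with
  | zero => simpa using hL
  | succ n ih =>
    calc B * s (L + n + 1) ≤ B * (B * s (L + n) ^ 2) := mul_le_mul_of_nonneg_left (h _) hB.le
      _ = (B * s (L + n)) ^ 2 := by ring
      _ ≤ (q ^ 2 ^ n) ^ 2 := pow_le_pow_left₀ (mul_nonneg hB.le (hs _)) ih 2
      _ = q ^ 2 ^ (n + 1) := by rw [← pow_mul, pow_succ]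

theorem exists_le_doubly_exp_of_succ_le_sq {s : ℕ → ℝ} {B : ℝ} (hs : ∀ n, 0 ≤ s n) (hB : 0 < B)
    (h : ∀ n, s (n + 1) ≤ B * s n ^ 2) (h0 : Filter.Tendsto s Filter.atTop (nhds 0)) :
    ∃ L, ∀ n, s (L + n) ≤ B⁻¹ * (1 / 2 : ℝ) ^ 2 ^ n := by
  have : ∀ᶠ n in Filter.atTop, B * s n < 1 / 2 := by
    have := h0.const_mul B
    rw [mul_zero] at this
    exact this.eventually_lt_const (by norm_num)
  obtain ⟨L, hL⟩ := this.exists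
  refine ⟨L, fun n => ?_⟩
  rw [inv_mul_eq_div, le_div_iff₀' hB]
  exact le_pow_two_pow_of_succ_le_sq hs hB h hL.le n

theorem doublyExpDecreasing_of_le {z s : ℕ → ℝ} {c B : ℝ} {L : ℕ} (hc : 0 < c) (hB : 0 < B)
    (hz : ∀ n, z n ≤ c * s n) (hs : ∀ n, s (L + n) ≤ B * (1 / 2 : ℝ) ^ 2 ^ n) :
    DoublyExpDecreasing z := by
  -- The base is chosen so that ω^(2^(L+m)) = (1/2)^(2^m), which absorbs the shift by L; taking L +
  -- 1 makes the threshold positive.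
  refine ⟨L + 1, (1 / 2 : ℝ) ^ ((2 : ℝ) ^ L)⁻¹, 2, c * B, Nat.succ_pos L, by positivity,
    Real.rpow_lt_one (by norm_num) (by norm_num) (by positivity), one_lt_two, by positivity, ?_⟩
  intro n hn
  obtain ⟨m, rfl⟩ := Nat.exists_eq_add_of_le ((Nat.le_succ L).trans hn)
  have e : ((1 / 2 : ℝ) ^ ((2 : ℝ) ^ L)⁻¹) ^ ((2 : ℝ) ^ (L + m)) = (1 / 2 : ℝ) ^ 2 ^ m := by
    have hm : (2 : ℝ) ^ m = ((2 ^ m : ℕ) : ℝ) := by push_cast; rfl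
    rw [← Real.rpow_mul (by norm_num), pow_add, inv_mul_cancel_left₀ (by positivity), hm,
      Real.rpow_natCast]
  rw [e, mul_assoc]
  exact (hz _).trans (mul_le_mul_of_nonneg_left (hs m) hc.le)

theorem le_inv_mul_agg (A : Admissible lam μ C γ) {j : Fin M} (hγj : 0 < γ j)
    (hP : P ∈ UbarM M) (n : ℕ) : P j n ≤ (γ j)⁻¹ * agg γ P n := by
  rw [inv_mul_eq_div, le_div_iff₀' hγj]
  exact Finset.single_le_sum (f := fun i => γ i * P i n)
    (fun i _ => mul_nonneg (A.γ_nonneg i) (nonneg_of_mem hP i n)) (Finset.mem_univ j)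

theorem exists_agg_le_doubly_exp (A : Admissible lam μ C γ) (hP : P ∈ UbarM M)
    (hle : ∀ m, ∑ j, γ j / nu lam μ C j * P j (m + 1) ≤ agg γ P m ^ 2)
    (h0 : ∀ j, Filter.Tendsto (P j) Filter.atTop (nhds 0)) :
    ∃ (L : ℕ) (B : ℝ), 0 < B ∧ ∀ n, agg γ P (L + n) ≤ B * (1 / 2 : ℝ) ^ 2 ^ n := by
  have hN : 0 < ∑ j, nu lam μ C j := by
    refine Finset.sum_pos (fun j _ => nu_pos A j) ?_
    by_contra hn
    have := A.γ_sum
    simp [Finset.not_nonempty_iff_eq_empty.1 hn] at this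
  have hlim : Filter.Tendsto (agg γ P) Filter.atTop (nhds 0) := by
    have : Filter.Tendsto (agg γ P) Filter.atTop (nhds (∑ i, γ i * 0)) :=
      tendsto_finsetSum _ fun i _ => (h0 i).const_mul _
    simpa using this
  obtain ⟨L, hL⟩ := exists_le_doubly_exp_of_succ_le_sq (agg_nonneg A hP) hN (fun n =>
    (agg_le_sum_nu_mul A fun j => nonneg_of_mem hP j (n + 1)).trans
      (mul_le_mul_of_nonneg_left (hle n) hN.le)) hlim
  exact ⟨L, _, inv_pos.2 hN, hL⟩

theorem summable_of_sum_le_sq (A : Admissible lam μ C γ) (hP : P ∈ UbarM M)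
    (hle : ∀ m, ∑ j, γ j / nu lam μ C j * P j (m + 1) ≤ agg γ P m ^ 2)
    (h0 : ∀ j, Filter.Tendsto (P j) Filter.atTop (nhds 0)) {j : Fin M} (hγj : 0 < γ j) :
    Summable (P j) := by
  obtain ⟨L, B, hB, hL⟩ := exists_agg_le_doubly_exp A hP hle h0
  rw [← summable_nat_add_iff L]
  refine Summable.of_nonneg_of_le (fun n => nonneg_of_mem hP j _) (fun n => ?_)
    ((summable_geometric_two.mul_left ((γ j)⁻¹ * B)))
  rw [add_comm n L, mul_assoc]
  refine (le_inv_mul_agg A hγj hP _).trans (mul_le_mul_of_nonneg_left ((hL n).trans ?_)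
    (inv_pos.2 hγj).le)
  exact mul_le_mul_of_nonneg_left (pow_le_pow_of_le_one (by norm_num) (by norm_num)
    Nat.lt_two_pow_self.le) hB.le

/-! ### Identities for an equilibrium of finite mean -/

theorem IsFixedPoint.sum_eq_sq (A : Admissible lam μ C γ) (hP : P ∈ UM M)
    (hfix : IsFixedPoint lam μ C γ P) (m : ℕ) :
    ∑ j, γ j / nu lam μ C j * P j (m + 1) = agg γ P m ^ 2 := by
  have h0 : ∀ j, Filter.Tendsto (P j) Filter.atTop (nhds 0) :=
    fun j => (hP j).2.tendsto_atTop_zero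
  have hN : Filter.Tendsto (fun N : ℕ => m + N) Filter.atTop Filter.atTop :=
    Filter.tendsto_atTop_mono (fun N => Nat.le_add_left N m) Filter.tendsto_id
  have hl1 : Filter.Tendsto (fun N => agg γ P (m + N)) Filter.atTop (nhds 0) := by
    have : Filter.Tendsto (fun N => agg γ P (m + N)) Filter.atTop (nhds (∑ i, γ i * 0)) :=
      tendsto_finsetSum _ fun i _ => ((h0 i).comp hN).const_mul _
    simpa using this
  have hl2 : Filter.Tendsto
      (fun N => ∑ j, γ j / nu lam μ C j * (P j (m + 1) - P j (m + N + 1))) Filter.atTop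
      (nhds (∑ j, γ j / nu lam μ C j * (P j (m + 1) - 0))) :=
    tendsto_finsetSum _ fun j _ => (tendsto_const_nhds.sub
      ((h0 j).comp ((Filter.tendsto_add_atTop_nat 1).comp hN))).const_mul _
  have hl := ((tendsto_const_nhds (x := agg γ P m ^ 2)).sub (hl1.pow 2)).const_mul lam |>.sub
    (hl2.const_mul lam)
  have hz := tendsto_nhds_unique hl ((tendsto_const_nhds (x := (0 : ℝ))).congr fun N => by
    rw [← sum_agg_h A]; simp [hfix _ _])
  have hlam := A.lam_pos
  simp only [sub_zero, zero_pow two_ne_zero, ← mul_sub] at hz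
  linarith [(mul_eq_zero.1 hz).resolve_left hlam.ne']

theorem summable_cross (hP : P ∈ UM M) (i j : Fin M) (k : ℕ) :
    Summable (fun l : ℕ =>
      γ i * (P i (k + l + 1) * P j (k + l) - P i (k + l) * P j (k + l + 1))) := by
  have hm : P ∈ UbarM M := fun j => (hP j).1
  have hs : Summable fun l => P j (k + l) := (hP j).2.comp_injective (add_right_injective k)
  have hs' : Summable fun l => P j (k + l + 1) :=
    (hP j).2.comp_injective ((add_left_injective 1).comp (add_right_injective k))
  refine Summable.mul_left (γ i) (Summable.sub (f := fun l => P i (k + l + 1) * P j (k + l))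
    (g := fun l => P i (k + l) * P j (k + l + 1)) ?_ ?_)
  · exact hs.of_nonneg_of_le
      (fun l => mul_nonneg (nonneg_of_mem hm i (k + l + 1)) (nonneg_of_mem hm j (k + l)))
      (fun l => mul_le_of_le_one_left (nonneg_of_mem hm j (k + l))
        (le_one_of_mem hm i (k + l + 1)))
  · exact hs'.of_nonneg_of_le
      (fun l => mul_nonneg (nonneg_of_mem hm i (k + l)) (nonneg_of_mem hm j (k + l + 1)))
      (fun l => mul_le_of_le_one_left (nonneg_of_mem hm j (k + l + 1))
        (le_one_of_mem hm i (k + l)))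

/-- With p_n = P^(j)_n, the product (p_n - p_{n+1})(a_n + a_{n+1}) is the telescoping difference p_n
a_n - p_{n+1} a_{n+1} plus the cross term p_n a_{n+1} - p_{n+1} a_n, in which the summand i = j
cancels. The stationary equations are summed over N coordinates and then N → ∞. -/
theorem IsFixedPoint.recursion (A : Admissible lam μ C γ) (hP : P ∈ UM M)
    (hfix : IsFixedPoint lam μ C γ P) (k : ℕ) (j : Fin M) :
    P j (k + 1) = nu lam μ C j *
      (γ j * P j k ^ 2 + P j k * (∑ i ∈ Finset.univ.erase j, γ i * P i k)
        + ∑ i ∈ Finset.univ.erase j, ∑' l : ℕ,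
            γ i * (P i (k + l + 1) * P j (k + l) - P i (k + l) * P j (k + l + 1))) := by
  have h0 : ∀ j, Filter.Tendsto (P j) Filter.atTop (nhds 0) :=
    fun j => (hP j).2.tendsto_atTop_zero
  have hN : Filter.Tendsto (fun N : ℕ => k + N) Filter.atTop Filter.atTop :=
    Filter.tendsto_atTop_mono (fun N => Nat.le_add_left N k) Filter.tendsto_id
  have hsplit : ∀ n, agg γ P n = γ j * P j n + ∑ i ∈ Finset.univ.erase j, γ i * P i n :=
    fun n => (Finset.add_sum_erase _ _ (Finset.mem_univ j)).symm
  have hl1 : Filter.Tendsto (fun N => agg γ P (k + N)) Filter.atTop (nhds 0) := by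
    have : Filter.Tendsto (fun N => agg γ P (k + N)) Filter.atTop (nhds (∑ i, γ i * 0)) :=
      tendsto_finsetSum _ fun i _ => ((h0 i).comp hN).const_mul _
    simpa using this
  have hsum : Filter.Tendsto (fun N => ∑ i ∈ Finset.univ.erase j, ∑ l ∈ Finset.range N,
      γ i * (P i (k + l + 1) * P j (k + l) - P i (k + l) * P j (k + l + 1))) Filter.atTop
      (nhds (∑ i ∈ Finset.univ.erase j, ∑' l : ℕ,
        γ i * (P i (k + l + 1) * P j (k + l) - P i (k + l) * P j (k + l + 1)))) :=
    tendsto_finsetSum _ fun i _ => (summable_cross hP i j k).hasSum.tendsto_sum_nat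
  have hfin : ∀ N, P j (k + 1) - P j (k + N + 1) = nu lam μ C j *
      (P j k * agg γ P k - P j (k + N) * agg γ P (k + N) +
        ∑ i ∈ Finset.univ.erase j, ∑ l ∈ Finset.range N,
          γ i * (P i (k + l + 1) * P j (k + l) - P i (k + l) * P j (k + l + 1))) := by
    intro N
    induction N with
    | zero => simp
    | succ N ih =>
      simp only [Finset.sum_range_succ, Finset.sum_add_distrib]
      have hh := hfix j (k + N + 1)
      have e1 : P j (k + N + 1) - P j (k + N + 2) = nu lam μ C j *
          ((P j (k + N) - P j (k + N + 1)) * (agg γ P (k + N) + agg γ P (k + N + 1))) := by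
        rw [h_succ] at hh
        have hp := mul_pos A.mu_pos (A.C_pos j)
        rw [nu, div_mul_eq_mul_div, eq_div_iff hp.ne']
        linarith
      have e2 : ∑ i ∈ Finset.univ.erase j,
          γ i * (P i (k + N + 1) * P j (k + N) - P i (k + N) * P j (k + N + 1)) =
          (agg γ P (k + N + 1) - γ j * P j (k + N + 1)) * P j (k + N)
            - (agg γ P (k + N) - γ j * P j (k + N)) * P j (k + N + 1) := by
        rw [hsplit, hsplit, add_sub_cancel_left, add_sub_cancel_left, Finset.sum_mul,
          Finset.sum_mul, ← Finset.sum_sub_distrib]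
        exact Finset.sum_congr rfl fun i _ => by ring
      rw [e2]
      simp only [← add_assoc]
      linear_combination ih + e1
  have hlim := (((tendsto_const_nhds (x := P j k * agg γ P k)).sub
    (((h0 j).comp hN).mul hl1)).add hsum).const_mul (nu lam μ C j)
  have hleft := (tendsto_const_nhds (x := P j (k + 1))).sub
    ((h0 j).comp ((Filter.tendsto_add_atTop_nat 1).comp hN))
  have := tendsto_nhds_unique (hleft.congr hfin) hlim
  rw [sub_zero, mul_zero, sub_zero, hsplit k] at this
  rw [this]; ring

end SQ2

/-! ### Global existence by monotone Picard iteration -/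

namespace SQ2

open Filter Set MeasureTheory

/-- The solution of the relaxation equation `x' = K (φ - x)`, `x 0 = a`. -/
noncomputable def relax (K a : ℝ) (φ : ℝ → ℝ) (t : ℝ) : ℝ :=
  Real.exp (-(K * t)) * (a + ∫ s in (0 : ℝ)..t, K * Real.exp (K * s) * φ s)

theorem relax_zero (K a : ℝ) (φ : ℝ → ℝ) : relax K a φ 0 = a := by simp [relax]

theorem hasDerivAt_relax (K a : ℝ) {φ : ℝ → ℝ} (hφ : Continuous φ) (t : ℝ) :
    HasDerivAt (relax K a φ) (K * (φ t - relax K a φ t)) t := by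
  have hc : Continuous fun s => K * Real.exp (K * s) * φ s := by fun_prop
  have h1 := (intervalIntegral.integral_hasDerivAt_right (hc.intervalIntegrable 0 t)
    (hc.stronglyMeasurableAtFilter _ _) hc.continuousAt).const_add a
  have h2 := (((hasDerivAt_id t).const_mul K).neg.exp).mul h1
  refine h2.congr_deriv ?_
  have he : Real.exp (-(K * t)) * Real.exp (K * t) = 1 := by rw [← Real.exp_add]; simp
  simp only [relax, id, mul_one, Pi.neg_apply]
  linear_combination (K * φ t) * he

theorem continuous_relax (K a : ℝ) {φ : ℝ → ℝ} (hφ : Continuous φ) :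
    Continuous (relax K a φ) :=
  continuous_iff_continuousAt.2 fun t => (hasDerivAt_relax K a hφ t).continuousAt

theorem relax_mono {K a b : ℝ} {φ ψ : ℝ → ℝ} (hK : 0 < K) (hφ : Continuous φ)
    (hψ : Continuous ψ) (hab : a ≤ b) (h : ∀ t, 0 ≤ t → φ t ≤ ψ t) {t : ℝ} (ht : 0 ≤ t) :
    relax K a φ t ≤ relax K b ψ t := by
  have := nonpos_of_deriv_add_le (K := K)
    (fun t _ => ((hasDerivAt_relax K a hφ t).sub (hasDerivAt_relax K b hψ t)).hasDerivWithinAt)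
    (fun t ht => ?_) ?_ ht
  · simpa using this
  · have := mul_le_mul_of_nonneg_left (h t ht) hK.le
    simp only [Pi.sub_apply]
    linarith
  · simpa [relax_zero] using hab

/-- Constants solve the relaxation equation, so the values 0 and 1 serve as barriers for the Picard
iterates. -/
theorem relax_const (K c : ℝ) (t : ℝ) : relax K c (fun _ => c) t = c := by
  have : ∫ s in (0 : ℝ)..t, K * Real.exp (K * s) * c =
      Real.exp (K * t) * c - Real.exp (K * 0) * c := by
    refine intervalIntegral.integral_eq_sub_of_hasDerivAt
      (f := fun s => Real.exp (K * s) * c) (fun s _ => ?_)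
      (Continuous.intervalIntegrable (by fun_prop) _ _)
    refine ((((hasDerivAt_id s).const_mul K).exp).mul_const c).congr_deriv ?_
    simp only [id, mul_one]; ring
  rw [relax, this]
  have he : Real.exp (-(K * t)) * Real.exp (K * t) = 1 := by rw [← Real.exp_add]; simp
  simp only [mul_zero, Real.exp_zero, one_mul]
  linear_combination c * he

variable {M : ℕ} {lam μ : ℝ} {C γ : Fin M → ℝ} {g : Fin M → ℕ → ℝ}

/-- Picard iterates for the equation `u' = rate * (euler u - u)`, started below the solution. -/
noncomputable def picard {M : ℕ} (lam μ : ℝ) (C γ : Fin M → ℝ) (g : Fin M → ℕ → ℝ) :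
    ℕ → ℝ → Fin M → ℕ → ℝ
  | 0 => fun _ => bot M
  | k + 1 => fun t j n =>
      relax (rate lam μ C) (g j n) (fun s => euler lam μ C γ (picard lam μ C γ g k s) j n) t

theorem continuous_euler {X : Type*} [TopologicalSpace X] {y : X → Fin M → ℕ → ℝ}
    (hy : ∀ j n, Continuous fun t => y t j n) (j : Fin M) (n : ℕ) :
    Continuous fun t => euler lam μ C γ (y t) j n :=
  continuous_iff_continuousAt.2 fun t => tendsto_euler (fun j n => (hy j n).tendsto t) j n

theorem continuous_picard (k : ℕ) (j : Fin M) (n : ℕ) :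
    Continuous fun t => picard lam μ C γ g k t j n := by
  induction k generalizing j n with
  | zero => exact continuous_const
  | succ k ih => exact continuous_relax _ _ (continuous_euler ih j n)

theorem picard_mem (A : Admissible lam μ C γ) (hg : g ∈ UbarM M) (k : ℕ) {t : ℝ} (ht : 0 ≤ t) :
    picard lam μ C γ g k t ∈ UbarM M := by
  induction k generalizing t with
  | zero => exact bot_mem M
  | succ k ih =>
    have hK := rate_pos A
    have hc := continuous_euler (lam := lam) (μ := μ) (C := C) (γ := γ)
      (continuous_picard (lam := lam) (μ := μ) (C := C) (γ := γ) (g := g) k)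
    intro j
    refine ⟨le_antisymm ?_ ?_, fun n => ⟨?_, ?_⟩⟩
    · refine (relax_mono (ψ := fun _ => 1) hK (hc j 0) continuous_const
        (zero_of_mem hg j).le (fun s hs => ?_) ht).trans_eq (relax_const _ _ _)
      exact le_one_of_mem (euler_mem A (ih hs)) j 0
    · refine (relax_const _ _ _).symm.trans_le (relax_mono (φ := fun _ => 1) hK continuous_const
        (hc j 0) (zero_of_mem hg j).ge (fun s hs => ?_) ht)
      exact (zero_of_mem (euler_mem A (ih hs)) j).ge
    · exact relax_mono hK (hc j (n + 1)) (hc j n) ((hg j).2 n).1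
        (fun s hs => (euler_mem A (ih hs) j |>.2 n).1) ht
    · refine (relax_const _ _ _).symm.trans_le (relax_mono (φ := fun _ => 0) hK continuous_const
        (hc j (n + 1)) ((hg j).2 n).2 (fun s hs => ?_) ht)
      exact (euler_mem A (ih hs) j |>.2 n).2

theorem picard_le_succ (A : Admissible lam μ C γ) (hg : g ∈ UbarM M) (k : ℕ) {t : ℝ}
    (ht : 0 ≤ t) : picard lam μ C γ g k t ≤ picard lam μ C γ g (k + 1) t := by
  induction k generalizing t with
  | zero => exact bot_le (picard_mem A hg 1 ht)
  | succ k ih =>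
    intro j n
    exact relax_mono (rate_pos A) (continuous_euler (continuous_picard k) j n)
      (continuous_euler (continuous_picard (k + 1)) j n) le_rfl
      (fun s hs => euler_mono A (picard_mem A hg k hs) (picard_mem A hg (k + 1) hs) (ih hs) j n) ht

/-- The derivative is `rate` times a difference of two numbers in [0, 1]. The constant does not
depend on k, so the limit is Lipschitz too. -/
theorem abs_picard_sub_le (A : Admissible lam μ C γ) (hg : g ∈ UbarM M) (k : ℕ) (j : Fin M)
    (n : ℕ) {s t : ℝ} (hs : 0 ≤ s) (ht : 0 ≤ t) :
    |picard lam μ C γ g (k + 1) t j n - picard lam μ C γ g (k + 1) s j n| ≤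
      rate lam μ C * |t - s| := by
  have hK := rate_pos A
  have := Convex.norm_image_sub_le_of_norm_hasDerivWithin_le (s := Ici (0 : ℝ))
    (f := fun t => picard lam μ C γ g (k + 1) t j n) (C := rate lam μ C)
    (fun t _ => (hasDerivAt_relax (rate lam μ C) (g j n)
      (continuous_euler (continuous_picard k) j n) t).hasDerivWithinAt)
    (fun t ht => ?_) (convex_Ici 0) hs ht
  · exact this
  · rw [Real.norm_eq_abs, abs_mul, abs_of_pos hK]
    refine mul_le_of_le_one_right hK.le ?_
    have h1 := euler_mem A (picard_mem A hg k ht)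
    have h2 := picard_mem A hg (k + 1) ht
    have h3 := nonneg_of_mem h2 j n
    have h4 := le_one_of_mem h2 j n
    have h5 := nonneg_of_mem h1 j n
    have h6 := le_one_of_mem h1 j n
    simp only [picard] at h3 h4
    rw [abs_le]
    constructor <;> linarith

/-- Global existence. -/
theorem exists_isSolution (A : Admissible lam μ C γ) (hg : g ∈ UbarM M) :
    ∃ u, IsSolution lam μ C γ g u := by
  have hK := rate_pos A
  let x : ℕ → ℝ → Fin M → ℕ → ℝ := picard lam μ C γ g
  let u : ℝ → Fin M → ℕ → ℝ := fun t j n => ⨆ k, x k t j n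
  have hlim : ∀ t, 0 ≤ t → ∀ j n, Tendsto (fun k => x k t j n) atTop (nhds (u t j n)) :=
    fun t ht j n => tendsto_atTop_ciSup
      (monotone_nat_of_le_succ fun k => picard_le_succ A hg k ht j n)
      ⟨1, by rintro _ ⟨k, rfl⟩; exact le_one_of_mem (picard_mem A hg k ht) j n⟩
  have hmem : ∀ t, 0 ≤ t → u t ∈ UbarM M := fun t ht =>
    mem_of_tendsto (fun k => picard_mem A hg k ht) (hlim t ht)
  have hlip : ∀ s t, 0 ≤ s → 0 ≤ t → ∀ j n, |u t j n - u s j n| ≤ rate lam μ C * |t - s| := by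
    intro s t hs ht j n
    refine le_of_tendsto ((tendsto_add_atTop_iff_nat 1).2
      ((hlim t ht j n).sub (hlim s hs j n)).abs) (Eventually.of_forall fun k => ?_)
    exact abs_picard_sub_le A hg k j n hs ht
  -- The iterates are controlled only for t ≥ 0; freezing the limit at its value at 0 for negative
  -- times makes it continuous on the whole line, as `relax` requires.
  have hcont : ∀ j n, Continuous fun t => u (max t 0) j n := by
    intro j n
    have : LipschitzWith (rate lam μ C).toNNReal fun t => u (max t 0) j n := by
      refine LipschitzWith.of_dist_le_mul fun t s => ?_
      rw [Real.dist_eq, Real.dist_eq, Real.coe_toNNReal _ hK.le]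
      refine (hlip _ _ (le_max_right s 0) (le_max_right t 0) j n).trans
        (mul_le_mul_of_nonneg_left ?_ hK.le)
      exact abs_max_sub_max_le_abs t s 0
    exact this.continuous
  have heq : ∀ t, 0 ≤ t → ∀ j n, u t j n =
      relax (rate lam μ C) (g j n) (fun s => euler lam μ C γ (u (max s 0)) j n) t := by
    intro t ht j n
    refine tendsto_nhds_unique ((hlim t ht j n).comp (tendsto_add_atTop_nat 1)) ?_
    refine ((intervalIntegral.tendsto_integral_filter_of_dominated_convergence
      (fun s => rate lam μ C * Real.exp (rate lam μ C * s)) (Eventually.of_forall fun k => ?_)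
      (Eventually.of_forall fun k => ?_) ?_ ?_).const_add (g j n)).const_mul _
    · have := continuous_euler (lam := lam) (μ := μ) (C := C) (γ := γ)
        (continuous_picard (lam := lam) (μ := μ) (C := C) (γ := γ) (g := g) k) j n
      exact Continuous.aestronglyMeasurable (by fun_prop)
    · refine ae_of_all _ fun s hs => ?_
      rw [uIoc_of_le ht] at hs
      have h1 := euler_mem A (picard_mem A hg k hs.1.le)
      have h2 : 0 ≤ rate lam μ C * Real.exp (rate lam μ C * s) := by positivity
      rw [Real.norm_eq_abs, abs_of_nonneg (mul_nonneg h2 (nonneg_of_mem h1 j n))]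
      exact mul_le_of_le_one_right h2 (le_one_of_mem h1 j n)
    · exact Continuous.intervalIntegrable (by fun_prop) _ _
    · refine ae_of_all _ fun s hs => ?_
      rw [uIoc_of_le ht] at hs
      simp only [max_eq_left hs.1.le]
      exact (tendsto_euler (hlim s hs.1.le) j n).const_mul _
  refine ⟨u, hmem, ?_, fun t ht j n => ?_⟩
  · funext j n
    rw [heq 0 le_rfl, relax_zero]
  · have h1 := (hasDerivAt_relax (rate lam μ C) (g j n)
      (continuous_euler (lam := lam) (μ := μ) (C := C) (γ := γ) hcont j n) t).hasDerivWithinAt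
      (s := Ici 0)
    rw [← heq t ht, max_eq_left ht, mul_sub, ← h_add_rate_mul A, add_sub_cancel_right] at h1
    exact h1.congr (fun s hs => heq s hs j n) (heq t ht j n)

end SQ2

/-! ### Convergence to the equilibrium -/

namespace SQ2

open Filter Set MeasureTheory

/-- A nonnegative Lipschitz function with a bounded primitive tends to `0`. -/
theorem tendsto_zero_of_primitive_le {f F : ℝ → ℝ} {K B : ℝ} (hK : 0 < K)
    (hf0 : ∀ t, 0 ≤ f t) (hf : ∀ s t, |f t - f s| ≤ K * |t - s|)
    (hF : ∀ t, HasDerivAt F (f t) t) (hB : ∀ t, F t ≤ B) : Tendsto f atTop (nhds 0) := by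
  have hmono : Monotone F := monotone_of_hasDerivAt_nonneg hF hf0
  have hlim := tendsto_atTop_ciSup hmono ⟨B, by rintro _ ⟨t, rfl⟩; exact hB t⟩
  -- By the mean value theorem the slope of F over [t, t + δ] is a value f ξ, which is within Kδ of
  -- f t. The slope tends to 0 because F converges.
  have key : ∀ δ, 0 < δ → ∀ t, f t ≤ K * δ + (F (t + δ) - F t) / δ := by
    intro δ hδ t
    obtain ⟨ξ, hξ, he⟩ := exists_hasDerivAt_eq_slope F f (lt_add_of_pos_right t hδ)
      (fun s _ => (hF s).continuousAt.continuousWithinAt) (fun s _ => hF s)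
    rw [add_sub_cancel_left] at he
    rw [← he]
    have h1 := (abs_le.1 (hf t ξ)).1
    have h2 : K * |ξ - t| ≤ K * δ :=
      mul_le_mul_of_nonneg_left (by rw [abs_of_pos (sub_pos.2 hξ.1)]; linarith [hξ.2]) hK.le
    linarith
  rw [Metric.tendsto_atTop]
  intro ε hε
  have hδ : 0 < ε / (2 * K) := by positivity
  have hd : Tendsto (fun t => K * (ε / (2 * K)) + (F (t + ε / (2 * K)) - F t) / (ε / (2 * K)))
      atTop (nhds (K * (ε / (2 * K)) + ((⨆ t, F t) - ⨆ t, F t) / (ε / (2 * K)))) :=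
    (((hlim.comp (tendsto_atTop_add_const_right _ _ tendsto_id)).sub hlim).div_const _).const_add _
  have hlt : K * (ε / (2 * K)) + ((⨆ t, F t) - ⨆ t, F t) / (ε / (2 * K)) < ε := by
    rw [sub_self, zero_div, add_zero]
    have : K * (ε / (2 * K)) = ε / 2 := by field_simp
    linarith
  obtain ⟨T, hT⟩ := eventually_atTop.1 (hd.eventually_lt_const hlt)
  refine ⟨T, fun t ht => ?_⟩
  rw [Real.dist_eq, sub_zero, abs_of_nonneg (hf0 t)]
  exact (key _ hδ t).trans_lt (hT t ht)

variable {M : ℕ} {lam μ : ℝ} {C γ : Fin M → ℝ} {g g' P : Fin M → ℕ → ℝ}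
  {u v : ℝ → Fin M → ℕ → ℝ}

theorem IsSolution.abs_sub_le (A : Admissible lam μ C γ) (hu : IsSolution lam μ C γ g u)
    (j : Fin M) (n : ℕ) {s t : ℝ} (hs : 0 ≤ s) (ht : 0 ≤ t) :
    |u t j n - u s j n| ≤ rate lam μ C * |t - s| :=
  Convex.norm_image_sub_le_of_norm_hasDerivWithin_le (f := fun t => u t j n)
    (fun t ht => hu.deriv t ht j n) (fun t ht => abs_h_le A (hu.mem t ht) j n)
    (convex_Ici 0) hs ht

/-- The mean queue length grows at rate at most 2λ: the bounds 2λ(u_n - u_{n+1}) on the field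
telescope to at most 2λ. -/
theorem IsSolution.sum_range_le (A : Admissible lam μ C γ) (hu : IsSolution lam μ C γ g u)
    (hg : g ∈ UM M) (j : Fin M) (N : ℕ) {t : ℝ} (ht : 0 ≤ t) :
    ∑ n ∈ Finset.range N, u t j (n + 1) ≤ ∑' n, g j n + 2 * lam * t := by
  have hd : ∀ t, 0 ≤ t → HasDerivWithinAt
      (fun s => ∑ n ∈ Finset.range N, u s j (n + 1) - 2 * lam * s)
      (∑ n ∈ Finset.range N, h lam μ C γ (u t) j (n + 1) - 2 * lam * 1) (Ici 0) t := fun t ht =>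
    (HasDerivWithinAt.fun_sum fun n _ => hu.deriv t ht j (n + 1)).sub
      ((hasDerivAt_id t).const_mul (2 * lam)).hasDerivWithinAt
  have := antitoneOn_of_hasDerivWithinAt_Ici hd (fun t ht => ?_) self_mem_Ici ht ht
  · simp only [mul_zero, sub_zero, hu.init] at this
    have h1 : ∑ n ∈ Finset.range N, g j (n + 1) ≤ ∑' n, g j n := by
      have hm : g ∈ UbarM M := fun j => (hg j).1
      refine le_trans ?_ ((hg j).2.sum_le_tsum (Finset.range (N + 1))
        fun n _ => nonneg_of_mem hm j n)
      rw [Finset.sum_range_succ']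
      linarith [nonneg_of_mem hm j 0]
    linarith
  · have h1 : ∑ n ∈ Finset.range N, h lam μ C γ (u t) j (n + 1) ≤
        ∑ n ∈ Finset.range N, 2 * lam * (u t j n - u t j (n + 1)) :=
      Finset.sum_le_sum fun n _ => h_succ_le A (hu.mem t ht) j n
    rw [← Finset.mul_sum, Finset.sum_range_sub'] at h1
    have h2 : u t j 0 - u t j N ≤ 1 := by
      linarith [zero_of_mem (hu.mem t ht) j, nonneg_of_mem (hu.mem t ht) j N]
    have h3 := mul_le_mul_of_nonneg_left h2 (mul_pos zero_lt_two A.lam_pos).le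
    linarith

/-- Monotonicity in n turns the bound on the mean into decay of order 1/N at each fixed time, which
disposes of the boundary term in `gapIntegral_bound`. -/
theorem IsSolution.mul_le (A : Admissible lam μ C γ) (hu : IsSolution lam μ C γ g u)
    (hg : g ∈ UM M) (j : Fin M) (N : ℕ) {t : ℝ} (ht : 0 ≤ t) :
    N * u t j N ≤ ∑' n, g j n + 2 * lam * t := by
  refine le_trans ?_ (hu.sum_range_le A hg j N ht)
  have : ∑ n ∈ Finset.range N, u t j N ≤ ∑ n ∈ Finset.range N, u t j (n + 1) :=
    Finset.sum_le_sum fun n hn =>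
      antitone_of_mem (hu.mem t ht) j (Finset.mem_range.1 hn)
  simpa using this

/-- The primitive of the difference of two solutions in one coordinate. -/
noncomputable def gapIntegral {M : ℕ} (u v : ℝ → Fin M → ℕ → ℝ) (j : Fin M) (n : ℕ) (t : ℝ) :
    ℝ := ∫ s in (0 : ℝ)..t, (v (max s 0) j n - u (max s 0) j n)

theorem IsSolution.continuous_max (A : Admissible lam μ C γ) (hu : IsSolution lam μ C γ g u)
    (j : Fin M) (n : ℕ) : Continuous fun t => u (max t 0) j n := by
  have hK := rate_pos A
  have : LipschitzWith (rate lam μ C).toNNReal fun t => u (max t 0) j n := by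
    refine LipschitzWith.of_dist_le_mul fun t s => ?_
    rw [Real.dist_eq, Real.dist_eq, Real.coe_toNNReal _ hK.le]
    exact (hu.abs_sub_le A j n (le_max_right s 0) (le_max_right t 0)).trans
      (mul_le_mul_of_nonneg_left (abs_max_sub_max_le_abs t s 0) hK.le)
  exact this.continuous

theorem hasDerivAt_gapIntegral (A : Admissible lam μ C γ) (hu : IsSolution lam μ C γ g u)
    (hv : IsSolution lam μ C γ g' v) (j : Fin M) (n : ℕ) (t : ℝ) :
    HasDerivAt (gapIntegral u v j n) (v (max t 0) j n - u (max t 0) j n) t := by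
  have hc := (hv.continuous_max A j n).sub (hu.continuous_max A j n)
  exact intervalIntegral.integral_hasDerivAt_right (hc.intervalIntegrable 0 t)
    (hc.stronglyMeasurableAtFilter _ _) hc.continuousAt

theorem gapIntegral_zero (j : Fin M) (n : ℕ) : gapIntegral u v j n 0 = 0 := by
  simp [gapIntegral]

theorem agg_sub_le (A : Admissible lam μ C γ) {x y : Fin M → ℕ → ℝ} (hxy : x ≤ y) (n : ℕ) :
    agg γ y n - agg γ x n ≤
      (∑ j, nu lam μ C j) * ∑ j, γ j / nu lam μ C j * (y j n - x j n) := by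
  have := agg_le_sum_nu_mul A (y := fun j => y j n - x j n) fun j => sub_nonneg.2 (hxy j n)
  simpa only [agg, mul_sub, Finset.sum_sub_distrib] using this

/-- The identity `sum_agg_h` is applied to both points and subtracted. At the far end the squares
and the x-term have a favourable sign, so only the y-term remains; at m, aggregates bounded by 1
make the difference of squares linear in the gap. -/
theorem sum_agg_h_sub_le (A : Admissible lam μ C γ) {x y : Fin M → ℕ → ℝ} (hx : x ∈ UbarM M)
    (hy : y ∈ UbarM M) (hxy : x ≤ y) (m N : ℕ) :
    ∑ n ∈ Finset.range N, ∑ j,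
        γ j * (h lam μ C γ y j (m + n + 1) - h lam μ C γ x j (m + n + 1)) ≤
      2 * lam * (∑ j, nu lam μ C j) * (∑ j, γ j / nu lam μ C j * (y j m - x j m))
        - lam * (∑ j, γ j / nu lam μ C j * (y j (m + 1) - x j (m + 1)))
        + lam * ∑ j, γ j / nu lam μ C j * y j (m + N + 1) := by
  have hl := A.lam_pos.le
  have e : ∑ n ∈ Finset.range N, ∑ j,
        γ j * (h lam μ C γ y j (m + n + 1) - h lam μ C γ x j (m + n + 1)) =
      lam * (agg γ y m ^ 2 - agg γ x m ^ 2)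
        - lam * (agg γ y (m + N) ^ 2 - agg γ x (m + N) ^ 2)
        - lam * (∑ j, γ j / nu lam μ C j * (y j (m + 1) - x j (m + 1)))
        + lam * (∑ j, γ j / nu lam μ C j * y j (m + N + 1))
        - lam * (∑ j, γ j / nu lam μ C j * x j (m + N + 1)) := by
    simp only [mul_sub (γ _), Finset.sum_sub_distrib, sum_agg_h A]
    simp only [mul_sub, Finset.sum_sub_distrib]
    ring
  rw [e]
  have h1 : agg γ y m ^ 2 - agg γ x m ^ 2 ≤
      2 * ((∑ j, nu lam μ C j) * ∑ j, γ j / nu lam μ C j * (y j m - x j m)) := by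
    have hs : 0 ≤ agg γ y m - agg γ x m := sub_nonneg.2 (agg_mono A hxy m)
    nlinarith [agg_sub_le A hxy m, agg_le_one A hx m, agg_le_one A hy m]
  have h2 : 0 ≤ agg γ y (m + N) ^ 2 - agg γ x (m + N) ^ 2 :=
    sub_nonneg.2 (pow_le_pow_left₀ (agg_nonneg A hx _) (agg_mono A hxy _) 2)
  have h3 : 0 ≤ ∑ j, γ j / nu lam μ C j * x j (m + N + 1) :=
    Finset.sum_nonneg fun j _ =>
      mul_nonneg (div_nonneg (A.γ_nonneg j) (nu_pos A j).le) (nonneg_of_mem hx j _)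
  linarith [mul_le_mul_of_nonneg_left h1 hl, mul_nonneg hl h2, mul_nonneg hl h3]

/-- Let D be the γ-weighted sum of the gaps beyond coordinate m. Up to truncation, D' ≤ 2λS · gap_m
- λ · gap_{m+1}. Since D ≥ 0 and D(0) is finite, a bound on ∫gap_m yields one on ∫gap_{m+1},
uniformly in time. The induction starts from gap_0 = 0. -/
theorem gapIntegral_bound (A : Admissible lam μ C γ) (hu : IsSolution lam μ C γ g u)
    (hv : IsSolution lam μ C γ g' v) (hg : g ∈ UbarM M) (hg' : g' ∈ UM M) (hgg : g ≤ g')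
    (m : ℕ) : ∃ B, ∀ t, 0 ≤ t → ∑ j, γ j / nu lam μ C j * gapIntegral u v j m t ≤ B := by
  have hl := A.lam_pos
  have hm' : g' ∈ UbarM M := fun j => (hg' j).1
  have hapos : ∀ j, 0 ≤ γ j / nu lam μ C j :=
    fun j => div_nonneg (A.γ_nonneg j) (nu_pos A j).le
  induction m with
  | zero =>
    refine ⟨0, fun t ht => le_of_eq (Finset.sum_eq_zero fun j _ => ?_)⟩
    have : ∀ s, v (max s 0) j 0 - u (max s 0) j 0 = 0 := fun s => by
      rw [zero_of_mem (hv.mem _ (le_max_right s 0)), zero_of_mem (hu.mem _ (le_max_right s 0)),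
        sub_self]
    simp [gapIntegral, this]
  | succ m ih =>
    obtain ⟨B, hB⟩ := ih
    set S := ∑ j, nu lam μ C j with hS
    have hS0 : 0 ≤ S := Finset.sum_nonneg fun j _ => (nu_pos A j).le
    set α := ∑ j, γ j / nu lam μ C j * ∑' n, g' j n with hα
    set β := lam * ∑ j, γ j / nu lam μ C j with hβ
    set D₀ := ∑ j, γ j * ∑' n, g' j n with hD₀
    have main : ∀ (N : ℕ) (t : ℝ), 0 ≤ t →
        lam * ∑ j, γ j / nu lam μ C j * gapIntegral u v j (m + 1) t ≤
          D₀ + 2 * lam * S * B + lam * (α * t + β * t ^ 2) * (1 / ((N : ℝ) + 1)) := by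
      intro N t ht
      -- The functional for the sum truncated at N. Its last term integrates the bound λ(α + 2βt)/(N
      -- + 1) on the truncation error, which vanishes as N → ∞ for fixed t.
      have hd : ∀ t, 0 ≤ t → HasDerivWithinAt (fun s =>
          (∑ n ∈ Finset.range N, ∑ j, γ j * (v s j (m + n + 1) - u s j (m + n + 1)))
          + lam * ∑ j, γ j / nu lam μ C j * gapIntegral u v j (m + 1) s
          - 2 * lam * S * ∑ j, γ j / nu lam μ C j * gapIntegral u v j m s
          - lam * (α * s + β * s ^ 2) * (1 / ((N : ℝ) + 1)))
          ((∑ n ∈ Finset.range N, ∑ j,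
            γ j * (h lam μ C γ (v t) j (m + n + 1) - h lam μ C γ (u t) j (m + n + 1)))
          + lam * ∑ j, γ j / nu lam μ C j * (v t j (m + 1) - u t j (m + 1))
          - 2 * lam * S * ∑ j, γ j / nu lam μ C j * (v t j m - u t j m)
          - lam * (α + 2 * β * t) * (1 / ((N : ℝ) + 1))) (Ici 0) t := by
        intro t ht
        have hG : ∀ j n, HasDerivWithinAt (gapIntegral u v j n) (v t j n - u t j n) (Ici 0) t := by
          intro j n
          have := (hasDerivAt_gapIntegral A hu hv j n t).hasDerivWithinAt (s := Ici 0)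
          rwa [max_eq_left ht] at this
        have hq : HasDerivAt (fun s : ℝ => lam * (α * s + β * s ^ 2) * (1 / ((N : ℝ) + 1)))
            (lam * (α + 2 * β * t) * (1 / ((N : ℝ) + 1))) t := by
          have := ((((hasDerivAt_id t).const_mul α).add
            (((hasDerivAt_id t).pow 2).const_mul β)).const_mul lam).mul_const (1 / ((N : ℝ) + 1))
          refine this.congr_deriv ?_
          simp only [id, mul_one, Nat.cast_ofNat]; ring
        exact (((HasDerivWithinAt.fun_sum fun n _ => HasDerivWithinAt.fun_sum fun j _ =>
          ((hv.deriv t ht j (m + n + 1)).sub (hu.deriv t ht j (m + n + 1))).const_mul (γ j)).add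
          ((HasDerivWithinAt.fun_sum fun j _ => (hG j (m + 1)).const_mul _).const_mul lam)).sub
          ((HasDerivWithinAt.fun_sum fun j _ => (hG j m).const_mul _).const_mul _)).sub
          hq.hasDerivWithinAt
      have hanti := antitoneOn_of_hasDerivWithinAt_Ici hd (fun t ht => ?_) self_mem_Ici ht ht
      · simp only [gapIntegral_zero, mul_zero, Finset.sum_const_zero, hu.init, hv.init, add_zero,
          sub_zero, zero_mul, zero_pow two_ne_zero] at hanti
        have h1 : 0 ≤ ∑ n ∈ Finset.range N, ∑ j,
            γ j * (v t j (m + n + 1) - u t j (m + n + 1)) :=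
          Finset.sum_nonneg fun n _ => Finset.sum_nonneg fun j _ =>
            mul_nonneg (A.γ_nonneg j) (sub_nonneg.2 (hu.mono A hv hgg ht j _))
        have h2 : ∑ n ∈ Finset.range N, ∑ j,
            γ j * (g' j (m + n + 1) - g j (m + n + 1)) ≤ D₀ := by
          rw [Finset.sum_comm]
          refine Finset.sum_le_sum fun j _ => ?_
          rw [← Finset.mul_sum]
          refine mul_le_mul_of_nonneg_left ?_ (A.γ_nonneg j)
          calc ∑ n ∈ Finset.range N, (g' j (m + n + 1) - g j (m + n + 1))
              ≤ ∑ n ∈ Finset.range N, g' j n := Finset.sum_le_sum fun n _ => by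
                have := antitone_of_mem hm' j (show n ≤ m + n + 1 by omega)
                linarith [nonneg_of_mem hg j (m + n + 1)]
            _ ≤ _ := (hg' j).2.sum_le_tsum _ fun n _ => nonneg_of_mem hm' j n
        have h3 := mul_le_mul_of_nonneg_left (hB t ht)
          (mul_nonneg (mul_nonneg zero_le_two hl.le) hS0)
        linarith
      · have h1 := sum_agg_h_sub_le A (hu.mem t ht) (hv.mem t ht) (hu.mono A hv hgg ht) m N
        have h2 : ∑ j, γ j / nu lam μ C j * v t j (m + N + 1) ≤
            (α + 2 * β * t) * (1 / ((N : ℝ) + 1)) := by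
          have e : α + 2 * β * t =
              ∑ j, γ j / nu lam μ C j * (∑' n, g' j n + 2 * lam * t) := by
            simp only [mul_add, Finset.sum_add_distrib, ← Finset.sum_mul, hα, hβ]
            ring
          rw [e, Finset.sum_mul]
          refine Finset.sum_le_sum fun j _ => ?_
          rw [mul_assoc]
          refine mul_le_mul_of_nonneg_left ?_ (hapos j)
          rw [mul_one_div, le_div_iff₀ (by positivity), mul_comm]
          refine le_trans ?_ (hv.mul_le A hg' j (N + 1) ht)
          push_cast
          refine mul_le_mul_of_nonneg_left ?_ (by positivity)
          exact antitone_of_mem (hv.mem t ht) j (by omega)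
        have h3 := mul_le_mul_of_nonneg_left h2 hl.le
        linarith
    refine ⟨(D₀ + 2 * lam * S * B) / lam, fun t ht => ?_⟩
    rw [le_div_iff₀' hl]
    have hlim := (tendsto_one_div_add_atTop_nhds_zero_nat (𝕜 := ℝ)).const_mul
      (lam * (α * t + β * t ^ 2)) |>.const_add (D₀ + 2 * lam * S * B)
    rw [mul_zero, add_zero] at hlim
    exact ge_of_tendsto' hlim fun N => main N t ht

/-- Two ordered solutions, the greater of which has finite mean, approach each other. -/
theorem tendsto_sub_of_le (A : Admissible lam μ C γ) (hγ : ∀ j, 0 < γ j)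
    (hu : IsSolution lam μ C γ g u)
    (hv : IsSolution lam μ C γ g' v) (hg : g ∈ UbarM M) (hg' : g' ∈ UM M) (hgg : g ≤ g')
    (j : Fin M) (n : ℕ) : Tendsto (fun t => v t j n - u t j n) atTop (nhds 0) := by
  have hK := rate_pos A
  obtain ⟨B, hB⟩ := gapIntegral_bound A hu hv hg hg' hgg n
  have hnn : ∀ s j, 0 ≤ v (max s 0) j n - u (max s 0) j n := fun s j =>
    sub_nonneg.2 (hu.mono A hv hgg (le_max_right s 0) j n)
  have hmono : ∀ j, Monotone (gapIntegral u v j n) := fun j =>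
    monotone_of_hasDerivAt_nonneg (hasDerivAt_gapIntegral A hu hv j n) fun s => hnn s j
  have ha : 0 < γ j / nu lam μ C j := div_pos (hγ j) (nu_pos A j)
  have hBj : ∀ t, gapIntegral u v j n t ≤ B / (γ j / nu lam μ C j) := by
    intro t
    rw [le_div_iff₀' ha]
    refine (mul_le_mul_of_nonneg_left (hmono j (le_max_left t 0)) ha.le).trans
      (le_trans ?_ (hB _ (le_max_right t 0)))
    refine Finset.single_le_sum
      (f := fun j => γ j / nu lam μ C j * gapIntegral u v j n (max t 0)) (fun i _ => ?_)
      (Finset.mem_univ j)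
    refine mul_nonneg (div_nonneg (A.γ_nonneg i) (nu_pos A i).le) ?_
    exact (gapIntegral_zero i n).symm.trans_le (hmono i (le_max_right t 0))
  have := tendsto_zero_of_primitive_le (f := fun s => v (max s 0) j n - u (max s 0) j n)
    (K := 2 * rate lam μ C) (by positivity) (fun s => hnn s j) (fun s t => ?_)
    (hasDerivAt_gapIntegral A hu hv j n) hBj
  · refine this.congr' ?_
    filter_upwards [eventually_ge_atTop 0] with t ht
    rw [max_eq_left ht]
  · have h1 := hv.abs_sub_le A j n (le_max_right s 0) (le_max_right t 0)
    have h2 := hu.abs_sub_le A j n (le_max_right s 0) (le_max_right t 0)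
    have h3 := mul_le_mul_of_nonneg_left (abs_max_sub_max_le_abs t s 0) hK.le
    calc |v (max t 0) j n - u (max t 0) j n - (v (max s 0) j n - u (max s 0) j n)|
        = |(v (max t 0) j n - v (max s 0) j n) - (u (max t 0) j n - u (max s 0) j n)| := by
          congr 1; ring
      _ ≤ |v (max t 0) j n - v (max s 0) j n| + |u (max t 0) j n - u (max s 0) j n| := abs_sub _ _
      _ ≤ 2 * rate lam μ C * |t - s| := by linarith

theorem IsFixedPoint.isSolution (hfix : IsFixedPoint lam μ C γ P) (hP : P ∈ UbarM M) :
    IsSolution lam μ C γ P fun _ => P where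
  mem _ _ := hP
  init := rfl
  deriv t _ j n := by
    rw [hfix j n]
    exact hasDerivWithinAt_const _ _ _

/-- The solution started at g ⊔ P, which still has finite mean, lies above both u and the constant
solution P, and each of them approaches it. -/
theorem IsSolution.tendsto_fixedPoint (A : Admissible lam μ C γ) (hγ : ∀ j, 0 < γ j)
    (hu : IsSolution lam μ C γ g u) (hg : g ∈ UM M) (hP : P ∈ UM M)
    (hfix : IsFixedPoint lam μ C γ P) (j : Fin M) (n : ℕ) :
    Tendsto (fun t => u t j n) atTop (nhds (P j n)) := by
  have hgm : g ∈ UbarM M := fun j => (hg j).1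
  have hPm : P ∈ UbarM M := fun j => (hP j).1
  have hs : g ⊔ P ∈ UM M := fun j => ⟨sup_mem hgm hPm j,
    ((hg j).2.add (hP j).2).of_nonneg_of_le (fun n => nonneg_of_mem (sup_mem hgm hPm) j n)
      fun n => sup_le (le_add_of_nonneg_right (nonneg_of_mem hPm j n))
        (le_add_of_nonneg_left (nonneg_of_mem hgm j n))⟩
  obtain ⟨v, hv⟩ := exists_isSolution A (sup_mem hgm hPm)
  have h1 := tendsto_sub_of_le A hγ hu hv hgm hs le_sup_left j n
  have h2 := tendsto_sub_of_le A hγ (hfix.isSolution hPm) hv hPm hs le_sup_right j n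
  have := (h2.sub h1).add_const (P j n)
  simpa using this

/-- On `UbarM M`, coordinatewise convergence is convergence in the weighted norm. -/
theorem tendsto_wnorm {ι : Type*} {l : Filter ι} {y : ι → Fin M → ℕ → ℝ}
    (hy : ∀ᶠ t in l, y t ∈ UbarM M) (hP : P ∈ UbarM M)
    (hlim : ∀ j n, Tendsto (fun t => y t j n) l (nhds (P j n))) :
    Tendsto (fun t => wnorm (y t - P)) l (nhds 0) := by
  rw [Metric.tendsto_nhds]
  intro ε hε
  -- Differences of points of `UbarM` are at most 1, so the weights make all coordinates n ≥ N
  -- contribute less than ε/2; finitely many coordinates remain.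
  obtain ⟨N, hN⟩ := exists_nat_one_div_lt (half_pos hε)
  have hev : ∀ᶠ t in l, ∀ j, ∀ n ∈ Finset.range N, |y t j n - P j n| < ε / 2 :=
    eventually_all.2 fun j => (Finset.eventually_all _).2 fun n _ => by
      simpa [Real.dist_eq] using (Metric.tendsto_nhds.1 (hlim j n)) _ (half_pos hε)
  filter_upwards [hy, hev] with t ht hsmall
  have hnn : 0 ≤ wnorm (y t - P) :=
    Real.iSup_nonneg fun j => Real.iSup_nonneg fun n => by positivity
  rw [Real.dist_eq, sub_zero, abs_of_nonneg hnn]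
  refine lt_of_le_of_lt ?_ (half_lt_self hε)
  refine Real.iSup_le (fun j => Real.iSup_le (fun n => ?_) (half_pos hε).le) (half_pos hε).le
  simp only [Pi.sub_apply]
  by_cases hn : n < N
  · refine (div_le_self (abs_nonneg _) ?_).trans (hsmall j n (Finset.mem_range.2 hn)).le
    linarith [Nat.cast_nonneg (α := ℝ) n]
  · have h1 : |y t j n - P j n| ≤ 1 := by
      rw [abs_le]
      constructor <;> linarith [nonneg_of_mem ht j n, le_one_of_mem ht j n, nonneg_of_mem hP j n,
        le_one_of_mem hP j n]
    have h2 : (N : ℝ) ≤ n := Nat.cast_le.2 (not_lt.1 hn)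
    refine le_trans ?_ hN.le
    exact div_le_div₀ zero_le_one h1 (by positivity) (by linarith)

end SQ2

theorem proposition3 (M : ℕ) (lam μ : ℝ) (hlam : 0 < lam) (hμ : 0 < μ)
    (C γ : Fin M → ℝ) (hC : ∀ j, 0 < C j) (hγ : ∀ j, 0 ≤ γ j) (hγsum : ∑ j, γ j = 1) :
    -- (i) global existence and uniqueness
    (∀ g ∈ SQ2.UbarM M, ∃ u : ℝ → Fin M → ℕ → ℝ, SQ2.IsSolution lam μ C γ g u ∧
      ∀ v : ℝ → Fin M → ℕ → ℝ, SQ2.IsSolution lam μ C γ g v → ∀ t, 0 ≤ t → v t = u t) ∧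
    (SQ2.StabilityCondition lam μ C γ →
      ∃ P ∈ SQ2.UM M,
        -- (ii) `P` is the unique fixed point with finite mean, and its properties
        SQ2.IsFixedPoint lam μ C γ P ∧
        (∀ Q ∈ SQ2.UM M, SQ2.IsFixedPoint lam μ C γ Q → Q = P) ∧
        (∀ (k : ℕ) (j : Fin M),
          (∀ i, i ≠ j → Summable (fun l : ℕ =>
            γ i * (P i (k + l + 1) * P j (k + l) - P i (k + l) * P j (k + l + 1)))) ∧
          P j (k + 1) = SQ2.nu lam μ C j *
            (γ j * P j k ^ 2 + P j k * (∑ i ∈ Finset.univ.erase j, γ i * P i k)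
              + ∑ i ∈ Finset.univ.erase j, ∑' l : ℕ,
                  γ i * (P i (k + l + 1) * P j (k + l) - P i (k + l) * P j (k + l + 1)))) ∧
        (∀ k : ℕ, ∑ j, γ j / SQ2.nu lam μ C j * P j (k + 1) = (∑ j, γ j * P j k) ^ 2) ∧
        (∀ j, SQ2.DoublyExpDecreasing (P j)) ∧
        -- (iii) every solution started in `UM M` converges to `P`
        (∀ g ∈ SQ2.UM M, ∀ u : ℝ → Fin M → ℕ → ℝ, SQ2.IsSolution lam μ C γ g u →
          Filter.Tendsto (fun t => SQ2.wnorm (u t - P)) Filter.atTop (nhds 0))) := by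
  have A : SQ2.Admissible lam μ C γ := ⟨hlam, hμ, hC, hγ, hγsum⟩
  refine ⟨fun g hg => ?_, fun hS => ?_⟩
  · obtain ⟨u, hu⟩ := SQ2.exists_isSolution A hg
    exact ⟨u, hu, fun v hv t ht => hv.eq A hu ht⟩
  have hpos := hS.γ_pos A
  obtain ⟨P, hPm, hfix, hle⟩ := SQ2.exists_fixedPoint_sum_le_sq A
  have h0 := SQ2.tendsto_zero_of_sum_le_sq A hS hPm hle
  have hP : P ∈ SQ2.UM M :=
    fun j => ⟨hPm j, SQ2.summable_of_sum_le_sq A hPm hle h0 (hpos j)⟩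
  refine ⟨P, hP, hfix, fun Q hQ hQfix => ?_,
    fun k j => ⟨fun i _ => SQ2.summable_cross hP i j k, hfix.recursion A hP k j⟩,
    hfix.sum_eq_sq A hP, fun j => ?_, fun g hg u hu => ?_⟩
  · funext j n
    -- The constant solution Q converges to P, hence equals it.
    exact tendsto_nhds_unique tendsto_const_nhds
      ((hQfix.isSolution fun j => (hQ j).1).tendsto_fixedPoint A hpos hQ hP hfix j n)
  · obtain ⟨L, B, hB, hL⟩ := SQ2.exists_agg_le_doubly_exp A hPm hle h0
    exact SQ2.doublyExpDecreasing_of_le (inv_pos.2 (hpos j)) hB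
      (SQ2.le_inv_mul_agg A (hpos j) hPm) hL
  · exact SQ2.tendsto_wnorm
      ((Filter.eventually_ge_atTop 0).mono fun t ht => hu.mem t ht) hPm
      (hu.tendsto_fixedPoint A hpos hg hP hfix)
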